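/- **Setting.** For each $I=1,2,\dots$ consider a matched study with $I$ matched sets; set $i$ has $n_i\ge 2$ units with fixed potential outcomes $Y_{ij}(1),Y_{ij}(0)$ (all quantities may depend on $I$). Exactly one unit per set is treated; independently across sets, unit $j$ of set $i$ is the treated one with probability $p^\star_{ij}$, where $\sum_j p^\star_{ij}=1$. Let $Z_{ij}\in\{0,1\}$ be the treatment indicators, $\mathcal Z$ the set of possible assignments, $Y_{ij}=Z_{ij}Y_{ij}(1)+(1-Z_{ij})Y_{ij}(0)$ the observed outcomes, and $\Gamma^\star_i=\max_jp^\star_{ij}/\min_jp^\star_{ij}\in[1,\infty]$ the hidden bias of set $i$ ($\infty$ if the minimum is $0$). For $v\in[1,\infty]^I$ let $v_{(1)}\le\dots\le v_{(I)}$ be its sorted coordinates, and for $\Gamma_0\in[-\infty,\infty]$ put $N_v(\Gamma_0)=\#\{i:v_i>\Gamma_0\}$; write $\Gamma^\star_{(k)}$ for the sorted hidden biases and $I^\star(\Gamma_0)=N_{\Gamma^\star}(\Gamma_0)$. The test statistic is $t(z,y)=\sum_{i,j}z_{ij}q_{ij}(y)$ with arbitrary functions $q_{ij}$ of the outcome vector.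 It is *effect increasing* if $t(z,y+z\circ\eta+(1-z)\circ\xi)\ge t(z,y)$ for all $z\in\mathcal Z$, $y$, and $\eta\ge0\ge\xi$, and *differential increasing* if $t(z,y+a\circ\eta)-t(z,y)\le t(a,y+a\circ\eta)-t(a,y)$ for all $z,a\in\mathcal Z$, $y$, and $\eta\ge 0$ (with $\circ$ and $\ge$ coordinatewise). **p-values.** Pretend that the sharp null of no effect holds, i.e. use the scores $q_{ij}=q_{ij}(Y)$ at the observed outcomes, and $T=t(Z,Y)$. Let $\mu_i(\Gamma)$ be the maximum of the mean $\sum_jp_jq_{ij}$ over the probability vectors $p$ on set $i$ with $\max p/\min p\le\Gamma$, and $v_i^2(\Gamma)$ the maximum of the variance $\sum_jp_jq_{ij}^2-(\sum_jp_jq_{ij})^2$ over those $p$ that maximize the mean (no constraint if $\Gamma=\infty$). For $J\subseteq\{1,\dots,I\}$ let $\mu(\Gamma_0;J)=\sum_{i\in J}\mu_i(\Gamma_0)+\sum_{i\notin J}\mu_i(\infty)$ and $\sigma^2(\Gamma_0;J)=\sum_{i\in J}v_i^2(\Gamma_0)+\sum_{i\notin J}v_i^2(\infty)$; let $\mu(\Gamma_0;k)$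 be the maximum of $\mu(\Gamma_0;J)$ over $|J|=k$ and $\sigma^2(\Gamma_0;k)$ the maximum of $\sigma^2(\Gamma_0;J)$ over the maximizing $J$. For $k\ge1$ let $\tilde p_{\Gamma_0;k}$ be $P\{\mathcal N(\mu(\Gamma_0;k),\sigma^2(\Gamma_0;k))\ge c\}$ at $c=T$ if $T\ge\mu(\Gamma_0;k)$, and $1$ otherwise; put $\tilde p_{\Gamma_0;0}=1$. Given sequences $\underline k_I$ and $\overline\Gamma_I$, let $p_{\Gamma_0;k}=\tilde p_{\Gamma_0;k}$ if $\Gamma_0\le\overline\Gamma_I$ and $k\ge\underline k_I$, and $p_{\Gamma_0;k}=1$ otherwise. (For $\Gamma_0<1$ and $k\ge 1$ the value of $p_{\Gamma_0;k}$ is immaterial.) **Conditions.** Still with $q_{ij}=q_{ij}(Y)$, let $R_i=\max_jq_{ij}-\min_jq_{ij}$, let $\mu_i,v_i^2$ be the mean and variance of $q_{ij}$ when $j$ is drawn with the true probabilities $p^\star_{ij}$, and let $D=\sum_iR_i^2/(n_i\Gamma_i^\star)^3$ (terms with $\Gamma_i^\star=\infty$ are $0$). Let $\mathcal I^\star_k$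 be the indices of the $k$ smallest $\Gamma^\star_i$, and $\mathcal I_{\Gamma_0;k}$ those of the $k$ sets of smallest rank when the sets are ranked increasingly by $\mu_i(\infty)-\mu_i(\Gamma_0)$ and ties decreasingly by $v_i^2(\Gamma_0)$; remaining ties are broken in any fixed way. For $\Gamma_i$ equal to $\Gamma_0$ if $i\in\mathcal I^\star_k$ and to $\infty$ otherwise, let $\mathcal A=\{i:v_i^2>v_i^2(\Gamma_i)\}$, and let $A_{\Gamma_0;k}$ be the average over $\mathcal A$ of $\mu_i(\Gamma_i)-\mu_i$ divided by the average over $\mathcal A$ of $v_i^2-v_i^2(\Gamma_i)$, times $\sqrt D$. Let $\mathcal B=\{(i,j):i\in\mathcal I_{\Gamma_0;k}\setminus\mathcal I^\star_k,\ j\in\mathcal I^\star_k\setminus\mathcal I_{\Gamma_0;k},\ v_i^2(\Gamma_0)<v_j^2(\Gamma_0)\}$, and let $B_{\Gamma_0;k}$ be the average over $\mathcal B$ of $\{\mu_j(\infty)-\mu_j(\Gamma_0)\}-\{\mu_i(\infty)-\mu_i(\Gamma_0)\}$ divided by the average over $\mathcal B$ of $v_j^2(\Gamma_0)-v_i^2(\Gamma_0)$,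 times $\{\sum_{i\in\mathcal I^\star_k}R_i^2/(n_i\Gamma_0)^3\}^{1/2}$. Set $A_{\Gamma_0;k}=\infty$ if $\mathcal A=\emptyset$ and $B_{\Gamma_0;k}=\infty$ if $\mathcal B=\emptyset$. The *uniform conditions in probability* say that, in probability as $I\to\infty$, (i) $\max_iR_i^2/D\to0$ (the ratio being $\infty$ if $D=0$), (ii) $\inf A_{\Gamma_0;k}\to\infty$ and (iii) $\inf B_{\Gamma_0;k}\to\infty$, where the infima are over $\max(1,\underline k_I)\le k\le I$ and $\Gamma_0\in[\Gamma^\star_{(k)},\overline\Gamma_I]$ (and $\inf\emptyset=\infty$). **Theorem.** Suppose that the bounded null $Y_{ij}(1)\le Y_{ij}(0)$ for all $i,j$ holds, that for each $I$ the statistic is effect increasing or differential increasing, and that the uniform conditions in probability hold. Let $\alpha\in(0,1)$, and write $C_k=\{\Gamma_0\in[1,\infty]:p_{\Gamma_0;k}>\alpha\}$ and $C'_{\Gamma_0}=\{I-k:p_{\Gamma_0;k}>\alpha,\ 0\le k\le I\}$. 1. For any $1\le k\le I$ ($k$ may vary with $I$), $C_k$ is an asymptotic $1-\alpha$ confidence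 set for $\Gamma^\star_{(k)}$: $\liminf_IP(\Gamma^\star_{(k)}\in C_k)\ge1-\alpha$. Moreover $C_k\subseteq[\inf C_k,\infty]$. 2. For any $\Gamma_0$ (real or $\pm\infty$, possibly varying with $I$), $C'_{\Gamma_0}$ is an asymptotic $1-\alpha$ confidence set for $I^\star(\Gamma_0)$, and $C'_{\Gamma_0}\subseteq\{\tilde I(\Gamma_0),\dots,I\}$ with $\tilde I(\Gamma_0)=I-\sup\{k:p_{\Gamma_0;k}>\alpha,0\le k\le I\}$. 3. Let $\mathcal S_{\Gamma_0;k}=\{v\in[1,\infty]^I:v_{(k)}\le\Gamma_0\}$ and let $\mathcal S^c_{\Gamma_0;k}$ be its complement in $[1,\infty]^I$. Viewed as confidence sets for the vector $\Gamma^\star$ (the vectors outside all rejected hypotheses $\mathcal S_{\Gamma_0;k}$), the confidence sets for all the $\Gamma^\star_{(k)}$ and those for all the $I^\star(\Gamma_0)$ have the same intersection: for every realization, $$\bigcap_{k=1}^I\ \bigcap_{\Gamma_0\ge1:\,p_{\Gamma_0;k}\le\alpha}\mathcal S^c_{\Gamma_0;k}=\bigcap_{\Gamma_0\ge1}\ \bigcap_{1\le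 k\le I:\,p_{\Gamma_0;k}\le\alpha}\mathcal S^c_{\Gamma_0;k}=\mathcal C:=\bigcap_{\Gamma_0\ge 1,\,1\le k\le I:\,p_{\Gamma_0;k}\le\alpha}\mathcal S^c_{\Gamma_0;k}.$$ The set $\mathcal C$ is contained in $\mathcal Q=\{v\in[1,\infty]^I:v_{(k)}\in C_k\text{ for }1\le k\le I\}$ and in $\mathcal Q'=\{v\in[1,\infty]^I:N_v(\Gamma_0)\in C'_{\Gamma_0}\text{ for all }\Gamma_0\ge1\}$. It equals $\mathcal Q$ whenever every $C_k$, $1\le k\le I$, is an upper set in $[1,\infty]$, and it equals $\mathcal Q'$ whenever $C'_{\Gamma_0}=\{\tilde I(\Gamma_0),\dots,I\}$ for all $\Gamma_0\ge1$. 4. The joint confidence set is asymptotically valid: $\liminf_IP(\Gamma^\star\in\mathcal C)\ge1-\alpha$; consequently the same holds with $\mathcal Q$ or $\mathcal Q'$ in place of $\mathcal C$. -/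

import Mathlib

open Filter Topology ProbabilityTheory Set
open scoped ENNReal

noncomputable section

namespace MatchedSets

/-! ### Matched studies, treatment assignments, test statistics -/

/-- A vector indexed by the units `(i, j)`, `j < n i`, of `I` matched sets of sizes `n i`. -/
abbrev UnitVec {I : ℕ} (n : Fin I → ℕ) : Type := ∀ i, Fin (n i) → ℝ

/-- A treatment assignment with exactly one treated unit in every matched set, encoded by the
treated unit `a i` of each set `i`. -/
abbrev Assignment {I : ℕ} (n : Fin I → ℕ) : Type := ∀ i, Fin (n i)

/-- The treatment indicators `z i j ∈ {0, 1}` of an assignment. -/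
def indicators {I : ℕ} {n : Fin I → ℕ} (a : Assignment n) : UnitVec n :=
  fun i j => if a i = j then 1 else 0

/-- A matched study with `I` sets: set sizes, treatment and control potential outcomes, and
within each set the true conditional probabilities `p i j` that unit `j` is the treated one. -/
structure Study (I : ℕ) where
  /-- the set sizes -/
  n : Fin I → ℕ
  two_le_n : ∀ i, 2 ≤ n i
  /-- the treatment potential outcomes -/
  Y1 : UnitVec n
  /-- the control potential outcomes -/
  Y0 : UnitVec n
  /-- the true treatment probabilities -/
  p : UnitVec n
  p_mem : ∀ i, p i ∈ stdSimplex ℝ (Fin (n i))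

/-- The bounded null hypothesis: no unit has a positive treatment effect. -/
def Study.BoundedNull {I : ℕ} (S : Study I) : Prop := S.Y1 ≤ S.Y0

/-- The observed outcomes under an assignment. They are also the control potential outcomes
imputed under the sharp null of no effect. -/
def Study.Yobs {I : ℕ} (S : Study I) (a : Assignment S.n) : UnitVec S.n :=
  indicators a * S.Y1 + (1 - indicators a) * S.Y0

/-- The probability of an event under the true assignment mechanism: the treated units are drawn
independently across sets, unit `j` of set `i` with probability `p i j`. -/
def Study.prob {I : ℕ} (S : Study I) (E : Set (Assignment S.n)) : ℝ :=
  ∑ a, E.indicator (fun a => ∏ i, S.p i (a i)) a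

/-- The statistic `t(z, y) = ∑ i, ∑ j, z i j * q i j`, with scores `q = q(y)`. -/
def stat {I : ℕ} {n : Fin I → ℕ} (q : UnitVec n → UnitVec n) (a : Assignment n)
    (y : UnitVec n) : ℝ :=
  ∑ i, ∑ j, indicators a i j * q y i j

def EffectIncreasing {I : ℕ} {n : Fin I → ℕ} (t : Assignment n → UnitVec n → ℝ) : Prop :=
  ∀ (a : Assignment n) (y η ξ : UnitVec n), 0 ≤ η → ξ ≤ 0 →
    t a y ≤ t a (y + indicators a * η + (1 - indicators a) * ξ)

def DifferentialIncreasing {I : ℕ} {n : Fin I → ℕ} (t : Assignment n → UnitVec n → ℝ) : Prop :=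
  ∀ (z a : Assignment n) (y η : UnitVec n), 0 ≤ η →
    t z (y + indicators a * η) - t z y ≤ t a (y + indicators a * η) - t a y

/-! ### Hidden biases -/

/-- The hidden bias `max p / min p` of a probability vector; it is `∞` when `min p = 0`. -/
def bias {m : ℕ} (p : Fin m → ℝ) : EReal :=
  (((⨆ j, ENNReal.ofReal (p j)) / (⨅ j, ENNReal.ofReal (p j)) : ℝ≥0∞) : EReal)

/-- The law of the treated unit of a set of size `m` under the sensitivity model with hidden bias
`G` and hidden confounding `u`. -/
def sensModel {m : ℕ} (G : ℝ) (u : Fin m → ℝ) : Fin m → ℝ :=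
  fun j => Real.exp (Real.log G * u j) / ∑ l, Real.exp (Real.log G * u l)

theorem bias_le_coe_iff {m : ℕ} {p : Fin m → ℝ} (hp : p ∈ stdSimplex ℝ (Fin m)) {G : ℝ}
    (hG : 1 ≤ G) : bias p ≤ (G : EReal) ↔ ∀ j l, p j ≤ G * p l := by
  have h0 : (⨆ j, ENNReal.ofReal (p j)) ≠ 0 := by
    intro h
    have h1 : ∀ j, p j = 0 := fun j => le_antisymm
      (ENNReal.ofReal_eq_zero.1 (le_antisymm (h ▸ le_iSup (fun j => ENNReal.ofReal (p j)) j)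
        bot_le)) (hp.1 j)
    have h2 := hp.2
    simp [h1] at h2
  have htop : (⨅ j, ENNReal.ofReal (p j)) ≠ ⊤ := by
    intro h
    apply h0
    rw [iInf_eq_top] at h
    have : IsEmpty (Fin m) := ⟨fun j => ENNReal.ofReal_ne_top (h j)⟩
    simp
  have hGe : (G : EReal) = ((ENNReal.ofReal G : ℝ≥0∞) : EReal) := by
    rw [EReal.coe_ennreal_ofReal, max_eq_left (by linarith)]
  rw [bias, hGe, EReal.coe_ennreal_le_coe_ennreal_iff,
    ENNReal.div_le_iff_le_mul (Or.inr ENNReal.ofReal_ne_top) (Or.inl htop) , iSup_le_iff]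
  · refine forall_congr' fun j => ?_
    rw [ENNReal.mul_iInf_of_ne (by simp; linarith) ENNReal.ofReal_ne_top, le_iInf_iff]
    refine forall_congr' fun l => ?_
    rw [← ENNReal.ofReal_mul (by linarith), ENNReal.ofReal_le_ofReal_iff]
    exact mul_nonneg (by linarith) (hp.1 l)

/-- A hidden bias at most `G` means that the sensitivity model with hidden bias `G` holds for some
hidden confounding in `[0, 1]`. -/
theorem bias_le_iff_sensModel {m : ℕ} {p : Fin m → ℝ} (hp : p ∈ stdSimplex ℝ (Fin m)) {G : ℝ}
    (hG : 1 ≤ G) :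
    bias p ≤ (G : EReal) ↔ ∃ u : Fin m → ℝ, (∀ j, u j ∈ Icc (0 : ℝ) 1) ∧ p = sensModel G u := by
  have hlog := Real.log_nonneg hG
  have hG0 : 0 < G := by linarith
  rw [bias_le_coe_iff hp hG]
  constructor
  · intro h
    have hm : Nonempty (Fin m) := by
      by_contra hm
      rw [not_nonempty_iff] at hm
      have h2 := hp.2
      simp at h2
    obtain ⟨j0, hj0⟩ := Finite.exists_min p
    have hpos : ∀ l, 0 < p l := by
      intro l
      refine lt_of_le_of_ne (hp.1 l) fun h0 => ?_
      have h1 : ∀ j, p j = 0 := fun j => le_antisymm (by simpa [← h0] using h j l) (hp.1 j)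
      have h2 := hp.2
      simp [h1] at h2
    have key : ∀ j, Real.exp (Real.log G * (Real.log (p j / p j0) / Real.log G)) = p j / p j0 := by
      intro j
      have hpj : 0 < p j / p j0 := div_pos (hpos j) (hpos j0)
      rcases hlog.eq_or_lt with hl | hl
      · have hG1 : G = 1 := by
          rcases Real.log_eq_zero.1 hl.symm with h | h | h <;> linarith
        have h1 : p j = p j0 := le_antisymm (by simpa [hG1] using h j j0) (hj0 j)
        rw [h1, div_self (hpos j0).ne']; simp
      · rw [mul_div_cancel₀ _ hl.ne', Real.exp_log hpj]
    refine ⟨fun j => Real.log (p j / p j0) / Real.log G, fun j => ⟨?_, ?_⟩, ?_⟩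
    · exact div_nonneg (Real.log_nonneg ((one_le_div (hpos j0)).2 (hj0 j))) hlog
    · refine div_le_one_of_le₀ (Real.log_le_log (div_pos (hpos j) (hpos j0)) ?_) hlog
      rw [div_le_iff₀ (hpos j0)]
      exact h j j0
    · funext j
      simp only [sensModel, key]
      rw [← Finset.sum_div, hp.2]
      field_simp [(hpos j0).ne']
  · rintro ⟨u, hu, rfl⟩ j l
    have hS : 0 < ∑ l, Real.exp (Real.log G * u l) :=
      Finset.sum_pos (fun i _ => Real.exp_pos _) ⟨j, Finset.mem_univ _⟩
    simp only [sensModel]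
    rw [← mul_div_assoc]
    refine div_le_div_of_nonneg_right ?_ hS.le
    conv_rhs => rw [← Real.exp_log hG0]
    rw [← Real.exp_add, Real.exp_le_exp, Real.log_exp]
    nlinarith [(hu j).2, (hu l).1]

/-- The vector of true hidden biases. -/
def Study.Γ {I : ℕ} (S : Study I) : Fin I → EReal := fun i => bias (S.p i)

/-- The `k`-th smallest coordinate of `G`, for `1 ≤ k ≤ I`. -/
def orderStat {I : ℕ} (G : Fin I → EReal) (k : ℕ) : EReal :=
  sInf {x | k ≤ (Finset.univ.filter fun i => G i ≤ x).card}

/-- The number of coordinates of `G` exceeding `x`. -/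
def numExceeding {I : ℕ} (G : Fin I → EReal) (x : EReal) : ℕ :=
  (Finset.univ.filter fun i => x < G i).card

/-! ### Extremal means and variances under a bound on the hidden bias -/

/-- The mean of the score of the treated unit. -/
def mean {m : ℕ} (p q : Fin m → ℝ) : ℝ := ∑ j, p j * q j

/-- The variance of the score of the treated unit. -/
def var {m : ℕ} (p q : Fin m → ℝ) : ℝ := ∑ j, p j * (q j - mean p q) ^ 2

/-- The maximum mean of the set-specific statistic when the hidden bias of the set is at most `G`.
For `G = ∞` every probability vector is allowed. -/
def maxMean {m : ℕ} (q : Fin m → ℝ) (G : EReal) : ℝ :=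
  sSup {x | ∃ p ∈ stdSimplex ℝ (Fin m), bias p ≤ G ∧ x = mean p q}

/-- The maximum variance of the set-specific statistic, given that its mean is maximized, when
the hidden bias of the set is at most `G`. -/
def maxVar {m : ℕ} (q : Fin m → ℝ) (G : EReal) : ℝ :=
  sSup {x | ∃ p ∈ stdSimplex ℝ (Fin m), bias p ≤ G ∧ mean p q = maxMean q G ∧ x = var p q}

/-- The bound `G` on the hidden biases of the sets in `J`, and no bound on the others. -/
def partialBound {I : ℕ} (J : Finset (Fin I)) (G : EReal) : Fin I → EReal :=
  fun i => if i ∈ J then G else ⊤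

/-- `μ(G; J)`, for the scores `w`. -/
def muOn {I : ℕ} {n : Fin I → ℕ} (w : UnitVec n) (G : EReal) (J : Finset (Fin I)) : ℝ :=
  ∑ i, maxMean (w i) (partialBound J G i)

/-- `σ²(G; J)`, for the scores `w`. -/
def varOn {I : ℕ} {n : Fin I → ℕ} (w : UnitVec n) (G : EReal) (J : Finset (Fin I)) : ℝ :=
  ∑ i, maxVar (w i) (partialBound J G i)

/-- `μ(G; k)`: the maximum of `μ(G; J)` over the sets `J` of cardinality `k`. -/
def muRank {I : ℕ} {n : Fin I → ℕ} (w : UnitVec n) (G : EReal) (k : ℕ) : ℝ :=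
  sSup {x | ∃ J : Finset (Fin I), J.card = k ∧ x = muOn w G J}

/-- `σ²(G; k)`: the maximum of `σ²(G; J)` over the sets `J` of cardinality `k` that maximize
`μ(G; J)`. -/
def varRank {I : ℕ} {n : Fin I → ℕ} (w : UnitVec n) (G : EReal) (k : ℕ) : ℝ :=
  sSup {x | ∃ J : Finset (Fin I), J.card = k ∧ muOn w G J = muRank w G k ∧ x = varOn w G J}

/-! ### p-values and confidence sets -/

/-- The p-value for the null "the hidden bias at rank `k` is at most `G`", at the value `T` of the
statistic and the scores `w`: the upper tail at `T` of the Gaussian law with mean `μ(G; k)` and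
variance `σ²(G; k)` if `T ≥ μ(G; k)`, and `1` otherwise. By convention it is `1` for `k = 0`. -/
def pValue {I : ℕ} {n : Fin I → ℕ} (w : UnitVec n) (T : ℝ) (G : EReal) (k : ℕ) : ℝ :=
  if 1 ≤ k ∧ muRank w G k ≤ T then
    (gaussianReal (muRank w G k) (varRank w G k).toNNReal).real (Ici T)
  else 1

/-- The modified p-value, set to `1` if `G > Gmax` or `k < kmin`, computed from the observed
data (treatment assignment `a` and observed outcomes) as if the sharp null of no effect held. -/
def Study.modP {I : ℕ} (S : Study I) (q : UnitVec S.n → UnitVec S.n) (kmin : ℕ) (Gmax : EReal)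
    (a : Assignment S.n) (G : EReal) (k : ℕ) : ℝ :=
  if G ≤ Gmax ∧ kmin ≤ k then pValue (q (S.Yobs a)) (stat q a (S.Yobs a)) G k else 1

variable {I : ℕ}

/-- The confidence set for the hidden bias at rank `k`, from the p-values `P`. -/
def quantileCI (P : EReal → ℕ → ℝ) (α : ℝ) (k : ℕ) : Set EReal :=
  {G | 1 ≤ G ∧ α < P G k}

/-- The confidence set for the number of hidden biases exceeding `G`, out of `I`. -/
def countCI (I : ℕ) (P : EReal → ℕ → ℝ) (α : ℝ) (G : EReal) : Set ℕ :=
  {l | ∃ k ≤ I, α < P G k ∧ l = I - k}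

/-- The lower confidence limit for the number of hidden biases exceeding `G`. -/
def countLower (I : ℕ) (P : EReal → ℕ → ℝ) (α : ℝ) (G : EReal) : ℕ :=
  I - sSup {k | k ≤ I ∧ α < P G k}

/-- The vectors of hidden biases in `[1, ∞]^I` whose `k`-th smallest coordinate is at most `G`. -/
def biasNull (I : ℕ) (G : EReal) (k : ℕ) : Set (Fin I → EReal) :=
  {v | (∀ i, 1 ≤ v i) ∧ orderStat v k ≤ G}

/-- The complement of `biasNull` in `[1, ∞]^I`. -/
def biasAlt (I : ℕ) (G : EReal) (k : ℕ) : Set (Fin I → EReal) :=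
  {v | ∀ i, 1 ≤ v i} \ biasNull I G k

/-- The vectors in `[1, ∞]^I` outside all rejected nulls at rank `k`. -/
def quantileRegion (I : ℕ) (P : EReal → ℕ → ℝ) (α : ℝ) (k : ℕ) : Set (Fin I → EReal) :=
  {v | (∀ i, 1 ≤ v i) ∧ ∀ G, 1 ≤ G → P G k ≤ α → v ∈ biasAlt I G k}

/-- The vectors in `[1, ∞]^I` outside all rejected nulls with threshold `G`. -/
def countRegion (I : ℕ) (P : EReal → ℕ → ℝ) (α : ℝ) (G : EReal) : Set (Fin I → EReal) :=
  {v | (∀ i, 1 ≤ v i) ∧ ∀ k, 1 ≤ k → k ≤ I → P G k ≤ α → v ∈ biasAlt I G k}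

/-- The vectors in `[1, ∞]^I` outside all rejected nulls, over all thresholds and ranks. -/
def jointRegion (I : ℕ) (P : EReal → ℕ → ℝ) (α : ℝ) : Set (Fin I → EReal) :=
  {v | (∀ i, 1 ≤ v i) ∧
    ∀ G k, 1 ≤ G → 1 ≤ k → k ≤ I → P G k ≤ α → v ∈ biasAlt I G k}

/-- The vectors in `[1, ∞]^I` all of whose order statistics lie in their confidence sets. -/
def allQuantiles (I : ℕ) (P : EReal → ℕ → ℝ) (α : ℝ) : Set (Fin I → EReal) :=
  {v | (∀ i, 1 ≤ v i) ∧ ∀ k, 1 ≤ k → k ≤ I → orderStat v k ∈ quantileCI P α k}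

/-- The vectors in `[1, ∞]^I` all of whose exceedance counts lie in their confidence sets. -/
def allCounts (I : ℕ) (P : EReal → ℕ → ℝ) (α : ℝ) : Set (Fin I → EReal) :=
  {v | (∀ i, 1 ≤ v i) ∧ ∀ G, 1 ≤ G → numExceeding v G ∈ countCI I P α G}

/-! ### Regularity conditions -/

/-- The range of the scores of a set. -/
def scoreRange {m : ℕ} (q : Fin m → ℝ) : ℝ := (⨆ j, q j) - ⨅ j, q j

/-- `R² / (m G)³` with `R` the range of the scores `q` of a set of size `m`; it is `0` for
`G = ∞`. -/
def scaledRange {m : ℕ} (q : Fin m → ℝ) (G : EReal) : ℝ :=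
  if G = ⊤ then 0 else scoreRange q ^ 2 / (m * G.toReal) ^ 3

/-- `∑ i, R i ² / (n i Γ⋆ i)³`. -/
def Study.scale (S : Study I) (w : UnitVec S.n) : ℝ := ∑ i, scaledRange (w i) (S.Γ i)

/-- `(max i, R i ²) / ∑ i, R i ² / (n i Γ⋆ i)³`; it is `∞` when the denominator vanishes. -/
def Study.rangeRatio (S : Study I) (w : UnitVec S.n) : EReal :=
  if S.scale w = 0 then ⊤ else (((⨆ i, scoreRange (w i) ^ 2) / S.scale w : ℝ) : EReal)

/-- The sets whose true variance exceeds the maximum variance under the bounds `G`. -/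
def Study.excess (S : Study I) (w : UnitVec S.n) (G : Fin I → EReal) : Finset (Fin I) :=
  Finset.univ.filter fun i => maxVar (w i) (G i) < var (S.p i) (w i)

/-- `Δ_μ(G)`. -/
def Study.deltaMean (S : Study I) (w : UnitVec S.n) (G : Fin I → EReal) : ℝ :=
  ((S.excess w G).card : ℝ)⁻¹ *
    ∑ i ∈ S.excess w G, (maxMean (w i) (G i) - mean (S.p i) (w i))

/-- `Δ_{v²}(G)`. -/
def Study.deltaVar (S : Study I) (w : UnitVec S.n) (G : Fin I → EReal) : ℝ :=
  ((S.excess w G).card : ℝ)⁻¹ *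
    ∑ i ∈ S.excess w G, (var (S.p i) (w i) - maxVar (w i) (G i))

/-- `Δ_μ(G) / Δ_{v²}(G) * √(∑ i, R i ² / (n i Γ⋆ i)³)`; it is `∞` when no set has an excess of
variance. -/
def Study.meanVarRatio (S : Study I) (w : UnitVec S.n) (G : Fin I → EReal) : EReal :=
  if S.excess w G = ∅ then ⊤
  else ((S.deltaMean w G / S.deltaVar w G * √(S.scale w) : ℝ) : EReal)

/-- `μ_i(∞) - μ_i(G)`. -/
def meanGap {m : ℕ} (q : Fin m → ℝ) (G : EReal) : ℝ := maxMean q ⊤ - maxMean q G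

/-- `J` consists of the indices of `k` smallest coordinates of `v` (with any choice at ties). -/
def IsSmallestSet (v : Fin I → EReal) (k : ℕ) (J : Finset (Fin I)) : Prop :=
  J.card = k ∧ ∀ i ∈ J, ∀ j ∉ J, v i ≤ v j

/-- `J` consists of the `k` sets of smallest rank, when the sets are ranked increasingly by
`μ_i(∞) - μ_i(G)`, and ties are ranked decreasingly by `v_i²(G)` (with any choice at the ties
that remain). -/
def IsRankSet {n : Fin I → ℕ} (w : UnitVec n) (G : EReal) (k : ℕ) (J : Finset (Fin I)) : Prop :=
  J.card = k ∧ ∀ i ∈ J, ∀ j ∉ J, meanGap (w i) G < meanGap (w j) G ∨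
    (meanGap (w i) G = meanGap (w j) G ∧ maxVar (w j) G ≤ maxVar (w i) G)

/-- The pairs `(i, j)` with `i ∈ Jhat \ Jstar`, `j ∈ Jstar \ Jhat` and `v_i²(G) < v_j²(G)`. -/
def swaps {n : Fin I → ℕ} (w : UnitVec n) (G : EReal) (Jstar Jhat : Finset (Fin I)) :
    Finset (Fin I × Fin I) :=
  ((Jhat \ Jstar) ×ˢ (Jstar \ Jhat)).filter fun x => maxVar (w x.1) G < maxVar (w x.2) G

/-- `Δ_μ(G; k)`. -/
def swapMean {n : Fin I → ℕ} (w : UnitVec n) (G : EReal) (Jstar Jhat : Finset (Fin I)) : ℝ :=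
  ((swaps w G Jstar Jhat).card : ℝ)⁻¹ *
    ∑ x ∈ swaps w G Jstar Jhat, (meanGap (w x.2) G - meanGap (w x.1) G)

/-- `Δ_{v²}(G; k)`. -/
def swapVar {n : Fin I → ℕ} (w : UnitVec n) (G : EReal) (Jstar Jhat : Finset (Fin I)) : ℝ :=
  ((swaps w G Jstar Jhat).card : ℝ)⁻¹ *
    ∑ x ∈ swaps w G Jstar Jhat, (maxVar (w x.2) G - maxVar (w x.1) G)

/-- `Δ_μ(G; k) / Δ_{v²}(G; k) * √(∑ i ∈ Jstar, R i ² / (n i G)³)`; it is `∞` when there is no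
pair to average over. -/
def swapRatio {n : Fin I → ℕ} (w : UnitVec n) (G : EReal) (Jstar Jhat : Finset (Fin I)) : EReal :=
  if swaps w G Jstar Jhat = ∅ then ⊤
  else ((swapMean w G Jstar Jhat / swapVar w G Jstar Jhat *
    √(∑ i ∈ Jstar, scaledRange (w i) G) : ℝ) : EReal)

/-- The infimum of `f k G` over the ranks `kmin ≤ k ≤ I` and the thresholds
`Γ⋆_(k) ≤ G ≤ Gmax`. -/
def Study.uniformInf (S : Study I) (kmin : ℕ) (Gmax : EReal) (f : ℕ → EReal → EReal) : EReal :=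
  sInf {x | ∃ k G, 1 ≤ k ∧ kmin ≤ k ∧ k ≤ I ∧ orderStat S.Γ k ≤ G ∧ G ≤ Gmax ∧ x = f k G}

/-- Convergence in probability to zero, along a sequence of studies, of nonnegative extended
real variables. -/
def TendstoZeroInProb (S : ∀ I, Study I) (X : ∀ I, Assignment (S I).n → EReal) : Prop :=
  ∀ ε : ℝ, 0 < ε → Tendsto (fun I => (S I).prob {a | (ε : EReal) < X I a}) atTop (𝓝 0)

/-- Convergence in probability to infinity, along a sequence of studies. -/
def TendstoTopInProb (S : ∀ I, Study I) (X : ∀ I, Assignment (S I).n → EReal) : Prop :=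
  ∀ C : ℝ, Tendsto (fun I => (S I).prob {a | X I a ≤ (C : EReal)}) atTop (𝓝 0)

/-- The uniform regularity conditions in probability, with the control potential outcomes replaced
by the imputed ones. Here `Jstar I k` are the `k` sets with smallest hidden biases, and
`Jhat I a G k` the `k` sets of smallest rank computed from the data under the assignment `a`. -/
structure UniformConditions (S : ∀ I, Study I) (q : ∀ I, UnitVec (S I).n → UnitVec (S I).n)
    (kmin : ℕ → ℕ) (Gmax : ℕ → EReal) (Jstar : ∀ I, ℕ → Finset (Fin I))
    (Jhat : ∀ I, Assignment (S I).n → EReal → ℕ → Finset (Fin I)) : Prop where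
  range_ratio : TendstoZeroInProb S fun I a => (S I).rangeRatio (q I ((S I).Yobs a))
  mean_var_ratio : TendstoTopInProb S fun I a =>
    (S I).uniformInf (kmin I) (Gmax I) fun k G =>
      (S I).meanVarRatio (q I ((S I).Yobs a)) (partialBound (Jstar I k) G)
  swap_ratio : TendstoTopInProb S fun I a =>
    (S I).uniformInf (kmin I) (Gmax I) fun k G =>
      swapRatio (q I ((S I).Yobs a)) G (Jstar I k) (Jhat I a G k)

/-- An assertion that random confidence regions have asymptotic coverage at least `1 - α`;
`E I` is the event of coverage in the `I`-th study. -/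
def AsympCovers (S : ∀ I, Study I) (α : ℝ) (E : ∀ I, Set (Assignment (S I).n)) : Prop :=
  1 - α ≤ liminf (fun I => (S I).prob (E I)) atTop

end MatchedSets

end

noncomputable section

namespace MatchedSets

open MeasureTheory

/-! All coverage claims follow from one simultaneous statement: for every `ε > 0`, eventually with
probability at least `1 - α - ε`, no true null among all pairs of a threshold `G` and a rank `k` is
rejected. The relations between the confidence regions are deterministic.

No multiplicity correction is needed, because every false rejection is traced back to the same
event. Freeze the scores imputed from the realized assignment `a`, and let `b` be an independent
draw. By `Study.exists_score_of_boundedNull` there is one function `h` of the assignment such that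
`h a ≤ h b` forces the frozen statistic at `b` to be at least its value at `a`. The upper tail of
`h` at `a` is thus at most the frozen tail. If a true null is rejected, then outside the bad events
of the regularity conditions `exists_tail_le_pValue` bounds the frozen tail by `α` plus a small
error. Hence `a` lies in the event that the tail of `h` is that small. This event involves neither
`G` nor `k`, and `Study.prob_tail_le` bounds its probability.

The tail bound holds because the frozen statistic is a sum of independent terms. Lindeberg's
argument gives a normal approximation whose error depends only on the largest standardized term,
hence is uniform over the scores; condition (i) makes that term small, since `D` is at most the
variance (`scaledRange_le_var`). The Gaussian law is then changed in steps: true means and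
variances, the extremal ones with bounds on `Jstar`, those with bounds on `Jhat`, and those of rank
`k`. The mean never decreases, but the variance may drop in the first two steps. `truncTail_le_max`
shows that a drop that is small relative to the gain in mean matters only far out in the tail;
conditions (ii) and (iii) say exactly that the drops are small in this sense. -/

/-! ### A nonasymptotic central limit theorem -/

/-- `f1` and `f2` are the coefficients of a second-order expansion of `f`, with remainder at most
`M * |h| ^ 3`. -/
def SecondOrderBound (M : ℝ) (f f1 f2 : ℝ → ℝ) : Prop :=
  ∀ x h, |f (x + h) - f x - h * f1 x - h ^ 2 / 2 * f2 x| ≤ M * |h| ^ 3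

/-- The transition is locally constant outside `[0, 1]`, so derivatives of positive order vanish
there; on `[0, 1]` compactness gives the bound. -/
theorem exists_bound_iteratedDeriv_smoothTransition (m : ℕ) :
    ∃ B, ∀ x, |iteratedDeriv (m + 1) Real.smoothTransition x| ≤ B := by
  have hc : Continuous (iteratedDeriv (m + 1) Real.smoothTransition) :=
    (Real.smoothTransition.contDiff (n := ⊤)).continuous_iteratedDeriv (m + 1)
      (by exact_mod_cast le_top)
  have hz : ∀ (s : Set ℝ) (b : ℝ), IsOpen s → (∀ y ∈ s, Real.smoothTransition y = b) →
      ∀ x ∈ s, iteratedDeriv (m + 1) Real.smoothTransition x = 0 := by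
    intro s b hs hb x hx
    have he : Real.smoothTransition =ᶠ[𝓝 x] fun _ => b := by
      filter_upwards [hs.mem_nhds hx] with y hy using hb y hy
    rw [he.iteratedDeriv_eq (m + 1)]
    simp [iteratedDeriv_const]
  obtain ⟨B, hB⟩ := (isCompact_Icc (a := (0 : ℝ)) (b := 1)).exists_bound_of_continuousOn
    hc.continuousOn
  refine ⟨B, fun x => ?_⟩
  have hB0 : 0 ≤ B := (norm_nonneg _).trans (hB 0 (by simp))
  by_cases h0 : x < 0
  · rw [hz (Iio 0) 0 isOpen_Iio (fun y hy => Real.smoothTransition.zero_of_nonpos (le_of_lt hy)) x h0]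
    simpa using hB0
  by_cases h1 : 1 < x
  · rw [hz (Ioi 1) 1 isOpen_Ioi (fun y hy => Real.smoothTransition.one_of_one_le (le_of_lt hy)) x h1]
    simpa using hB0
  exact hB x ⟨not_lt.1 h0, not_lt.1 h1⟩

/-- Taylor's formula with Lagrange remainder; the factor `1 / 6` is given away. -/
theorem secondOrderBound_of_contDiff {f : ℝ → ℝ} (hf : ContDiff ℝ 3 f) {B : ℝ}
    (hB : ∀ x, |iteratedDeriv 3 f x| ≤ B) :
    SecondOrderBound B f (deriv f) (iteratedDeriv 2 f) := by
  intro x h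
  rcases eq_or_ne h 0 with rfl | hh
  · simp
  have hx : x ≠ x + h := by simpa using hh
  obtain ⟨y, -, hy⟩ := taylor_mean_remainder_lagrange_iteratedDeriv (n := 2) hx
    (hf.contDiffOn.of_le (by norm_num))
  have hu := uniqueDiffOn_uIcc hx
  have hd : ∀ k : ℕ, k ≤ 3 → iteratedDerivWithin k f (uIcc x (x + h)) x = iteratedDeriv k f x :=
    fun k hk => iteratedDerivWithin_eq_iteratedDeriv hu
      ((hf.of_le (by exact_mod_cast hk)).contDiffAt) left_mem_uIcc
  rw [taylorWithinEval_succ, taylorWithinEval_succ, taylor_within_zero_eval, hd 1 (by norm_num),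
    hd 2 (by norm_num), iteratedDeriv_one] at hy
  simp at hy
  have h3 : f (x + h) - f x - h * deriv f x - h ^ 2 / 2 * iteratedDeriv 2 f x =
      iteratedDeriv 3 f y * h ^ 3 / 6 := by
    norm_num [Nat.factorial] at hy
    rw [← hy]; ring
  rw [h3, abs_div, abs_mul, abs_pow]
  have h4 : |iteratedDeriv 3 f y| * |h| ^ 3 ≤ B * |h| ^ 3 := by gcongr; exact hB y
  have h5 : 0 ≤ |iteratedDeriv 3 f y| * |h| ^ 3 := by positivity
  rw [abs_of_pos (by norm_num : (0 : ℝ) < 6)]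
  linarith

/-- Smooth approximations of the indicator of a half line, with expansions. -/
theorem exists_smooth_step : ∃ M : ℝ, 0 ≤ M ∧ ∀ η : ℝ, 0 < η → ∀ c : ℝ, ∃ f f1 f2 : ℝ → ℝ, ∃ B : ℝ,
    Continuous f ∧ Continuous f1 ∧ Continuous f2 ∧
    (∀ x, |f x| ≤ B) ∧ (∀ x, |f1 x| ≤ B) ∧ (∀ x, |f2 x| ≤ B) ∧
    SecondOrderBound (M / η ^ 3) f f1 f2 ∧ (∀ x, c ≤ x → f x = 1) ∧ (∀ x, x ≤ c - η → f x = 0) ∧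
    (∀ x, 0 ≤ f x) ∧ ∀ x, f x ≤ 1 := by
  obtain ⟨B1, h1⟩ := exists_bound_iteratedDeriv_smoothTransition 0
  obtain ⟨B2, h2⟩ := exists_bound_iteratedDeriv_smoothTransition 1
  obtain ⟨M, h3⟩ := exists_bound_iteratedDeriv_smoothTransition 2
  norm_num at h1 h2 h3
  have hsm : ContDiff ℝ 3 Real.smoothTransition := Real.smoothTransition.contDiff (n := 3)
  have hb := secondOrderBound_of_contDiff hsm h3
  have hM : 0 ≤ M := (abs_nonneg _).trans (h3 0)
  refine ⟨M, hM, fun η hη c => ?_⟩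
  set g := Real.smoothTransition with hg
  have hc1 : Continuous (deriv g) := by
    simpa using hsm.continuous_iteratedDeriv 1 (by norm_num)
  have hc2 : Continuous (iteratedDeriv 2 g) := hsm.continuous_iteratedDeriv 2 (by norm_num)
  -- The transition is moved from `[0, 1]` to `[c - η, c]`. Rescaling multiplies the third
  -- derivative by `η⁻³`, so `M` depends on neither `c` nor `η`.
  refine ⟨fun x => g ((x - (c - η)) / η), fun x => η⁻¹ * deriv g ((x - (c - η)) / η),
    fun x => (η ^ 2)⁻¹ * iteratedDeriv 2 g ((x - (c - η)) / η),
    max 1 (max (η⁻¹ * B1) ((η ^ 2)⁻¹ * B2)), ?_, ?_, ?_, ?_, ?_, ?_, ?_, ?_, ?_, ?_, ?_⟩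
  · exact hsm.continuous.comp (by fun_prop)
  · exact continuous_const.mul (hc1.comp (by fun_prop))
  · exact continuous_const.mul (hc2.comp (by fun_prop))
  · intro x
    rw [abs_of_nonneg (Real.smoothTransition.nonneg _)]
    exact (Real.smoothTransition.le_one _).trans (le_max_left _ _)
  · intro x
    rw [abs_mul, abs_of_pos (inv_pos.2 hη)]
    exact le_trans (mul_le_mul_of_nonneg_left (h1 _) (by positivity))
      ((le_max_left _ _).trans (le_max_right _ _))
  · intro x
    rw [abs_mul, abs_of_pos (inv_pos.2 (pow_pos hη 2))]
    exact le_trans (mul_le_mul_of_nonneg_left (h2 _) (by positivity))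
      ((le_max_right _ _).trans (le_max_right _ _))
  · intro x h
    have h4 := hb ((x - (c - η)) / η) (h / η)
    have e1 : (x + h - (c - η)) / η = (x - (c - η)) / η + h / η := by ring
    rw [abs_div, abs_of_pos hη] at h4
    calc _ = |g ((x - (c - η)) / η + h / η) - g ((x - (c - η)) / η) -
          h / η * deriv g ((x - (c - η)) / η) -
          (h / η) ^ 2 / 2 * iteratedDeriv 2 g ((x - (c - η)) / η)| := by
            simp only [e1]; congr 1; field_simp
      _ ≤ _ := h4
      _ = M / η ^ 3 * |h| ^ 3 := by rw [div_pow]; ring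
  · intro x hx
    exact Real.smoothTransition.one_of_one_le (by rw [le_div_iff₀ hη]; linarith)
  · intro x hx
    exact Real.smoothTransition.zero_of_nonpos (div_nonpos_of_nonpos_of_nonneg (by linarith) hη.le)
  · exact fun x => Real.smoothTransition.nonneg _
  · exact fun x => Real.smoothTransition.le_one _

theorem integrable_comp_add_of_bounded {μ : Measure ℝ} [IsProbabilityMeasure μ] {f : ℝ → ℝ}
    (hf : Continuous f) {B : ℝ} (hB : ∀ x, |f x| ≤ B) (s : ℝ) :
    Integrable (fun z => f (s + z)) μ :=
  Integrable.of_bound (C := B) (by fun_prop) (ae_of_all _ fun z => hB _)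

/-- The expansion of a Gaussian mean. -/
theorem abs_integral_gaussianReal_sub_le {M : ℝ} {g g1 g2 : ℝ → ℝ}
    (hM : SecondOrderBound M g g1 g2) (hg : ∀ (s : ℝ) (v : NNReal),
      Integrable (fun z => g (s + z)) (gaussianReal 0 v)) (s : ℝ) (v : NNReal) :
    |∫ z, g (s + z) ∂gaussianReal 0 v - (g s + v / 2 * g2 s)| ≤
      M * ((∫ z, |z| ^ 3 ∂gaussianReal 0 1) * √v ^ 3) := by
  have i1 : Integrable (fun z : ℝ => z) (gaussianReal 0 v) :=
    memLp_one_iff_integrable.1 (memLp_id_gaussianReal' 1 (by simp))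
  have i2 : Integrable (fun z : ℝ => z ^ 2) (gaussianReal 0 v) :=
    (memLp_id_gaussianReal' 2 (by simp)).integrable_sq
  have i3 : Integrable (fun z : ℝ => |z| ^ 3) (gaussianReal 0 v) := by
    simpa using (memLp_id_gaussianReal' (μ := 0) (v := v) 3 (by simp)).integrable_norm_pow
      (p := 3) (by norm_num)
  have m2 : ∫ z, z ^ 2 ∂gaussianReal 0 v = v := by
    have h := variance_fun_id_gaussianReal (μ := 0) (v := v)
    rw [variance_eq_integral (by fun_prop)] at h
    simpa using h
  -- A centered Gaussian of variance `v` is `√v` times a standard one.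
  have m3 : ∫ z, |z| ^ 3 ∂gaussianReal 0 v = (∫ z, |z| ^ 3 ∂gaussianReal 0 1) * √v ^ 3 := by
    have h := gaussianReal_map_const_mul (μ := 0) (v := 1) (√v)
    have h2 : gaussianReal 0 v = (gaussianReal 0 1).map (fun x => √v * x) := by
      rw [h]
      congr 1
      · simp
      · ext; simp
    rw [h2, integral_map (by fun_prop) (by fun_prop), ← integral_mul_const]
    refine integral_congr_ae (ae_of_all _ fun z => ?_)
    simp only [abs_mul, mul_pow, abs_of_nonneg (Real.sqrt_nonneg _)]
    ring
  have e : ∫ z, g (s + z) ∂gaussianReal 0 v - (g s + v / 2 * g2 s) =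
      ∫ z, (g (s + z) - g s - z * g1 s - z ^ 2 / 2 * g2 s) ∂gaussianReal 0 v := by
    rw [integral_sub, integral_sub, integral_sub, integral_mul_const, integral_mul_const,
      integral_div, m2, integral_id_gaussianReal]
    · simp; ring
    · exact hg s v
    · exact integrable_const _
    · exact (hg s v).sub (integrable_const _)
    · exact i1.mul_const _
    · exact ((hg s v).sub (integrable_const _)).sub (i1.mul_const _)
    · exact (i2.div_const _).mul_const _
  rw [e, ← m3, ← integral_const_mul]
  refine abs_integral_le_integral_abs.trans (integral_mono_of_nonneg
    (ae_of_all _ fun z => abs_nonneg _) (i3.const_mul _) (ae_of_all _ fun z => hM s z))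

/-- The expansion of the mean under a finitely supported law. -/
theorem abs_sum_sub_le {M : ℝ} {g g1 g2 : ℝ → ℝ} (hM : SecondOrderBound M g g1 g2) {m : ℕ}
    {p x : Fin m → ℝ} (hp : p ∈ stdSimplex ℝ (Fin m)) (hx : ∑ j, p j * x j = 0) (s : ℝ) :
    |∑ j, p j * g (s + x j) - (g s + (∑ j, p j * x j ^ 2) / 2 * g2 s)| ≤
      M * ∑ j, p j * |x j| ^ 3 := by
  have e : ∑ j, p j * g (s + x j) - (g s + (∑ j, p j * x j ^ 2) / 2 * g2 s) =
      ∑ j, p j * (g (s + x j) - g s - x j * g1 s - x j ^ 2 / 2 * g2 s) := by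
    have h1 : ∑ j, p j * g s = g s := by rw [← Finset.sum_mul, hp.2, one_mul]
    have h2 : ∑ j, p j * x j * g1 s = 0 := by rw [← Finset.sum_mul, hx, zero_mul]
    have h3 : ∑ j, p j * x j ^ 2 * (g2 s / 2) = (∑ j, p j * x j ^ 2) / 2 * g2 s := by
      rw [← Finset.sum_mul]; ring
    calc _ = ∑ j, p j * g (s + x j) - ∑ j, p j * g s - ∑ j, p j * x j * g1 s
          - ∑ j, p j * x j ^ 2 * (g2 s / 2) := by rw [h1, h2, h3]; ring
      _ = _ := by
        rw [← Finset.sum_sub_distrib, ← Finset.sum_sub_distrib, ← Finset.sum_sub_distrib]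
        exact Finset.sum_congr rfl fun j _ => by ring
  rw [e, Finset.mul_sum]
  refine (Finset.abs_sum_le_sum_abs _ _).trans (Finset.sum_le_sum fun j _ => ?_)
  rw [abs_mul, abs_of_nonneg (hp.1 j)]
  nlinarith [mul_le_mul_of_nonneg_left (hM s (x j)) (hp.1 j)]

/-- Averaging over translates keeps the constant `M`. This lets the induction in `lindeberg` apply
the expansion after the other sets have been replaced by Gaussians. -/
theorem secondOrderBound_integral {M : ℝ} {f f1 f2 : ℝ → ℝ} {B : ℝ}
    (hM : SecondOrderBound M f f1 f2) (hf : Continuous f) (hf1 : Continuous f1)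
    (hf2 : Continuous f2) (hB : ∀ x, |f x| ≤ B) (hB1 : ∀ x, |f1 x| ≤ B) (hB2 : ∀ x, |f2 x| ≤ B)
    (μ : Measure ℝ) [IsProbabilityMeasure μ] :
    SecondOrderBound M (fun s => ∫ z, f (s + z) ∂μ) (fun s => ∫ z, f1 (s + z) ∂μ)
      (fun s => ∫ z, f2 (s + z) ∂μ) := by
  intro x h
  have i0 := fun s => integrable_comp_add_of_bounded (μ := μ) hf hB s
  have i1 := fun s => integrable_comp_add_of_bounded (μ := μ) hf1 hB1 s
  have i2 := fun s => integrable_comp_add_of_bounded (μ := μ) hf2 hB2 s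
  have e : ∫ z, (f (x + h + z) - f (x + z) - h * f1 (x + z) - h ^ 2 / 2 * f2 (x + z)) ∂μ =
      ∫ z, f (x + h + z) ∂μ - ∫ z, f (x + z) ∂μ - h * ∫ z, f1 (x + z) ∂μ -
        h ^ 2 / 2 * ∫ z, f2 (x + z) ∂μ := by
    rw [integral_sub, integral_sub, integral_sub, integral_const_mul, integral_const_mul]
    · exact i0 _
    · exact i0 _
    · exact (i0 _).sub (i0 _)
    · exact (i1 _).const_mul _
    · exact ((i0 _).sub (i0 _)).sub ((i1 _).const_mul _)
    · exact (i2 _).const_mul _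
  simp only
  rw [← e]
  have h1 : ‖∫ z, (f (x + h + z) - f (x + z) - h * f1 (x + z) - h ^ 2 / 2 * f2 (x + z)) ∂μ‖ ≤
      M * |h| ^ 3 * μ.real univ := by
    refine norm_integral_le_of_norm_le_const (ae_of_all _ fun z => ?_)
    have := hM (x + z) h
    rw [show x + z + h = x + h + z by ring] at this
    exact this
  simpa using h1

/-- Sums over assignments, split at the first set. -/
theorem sum_assignment_succ {I : ℕ} {n : Fin (I + 1) → ℕ} (F : Assignment n → ℝ) :
    ∑ a, F a = ∑ j : Fin (n 0), ∑ b : ∀ i : Fin I, Fin (n i.succ), F (Fin.cons j b) := by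
  rw [← (Fin.consEquiv fun i => Fin (n i)).sum_comp, Fintype.sum_prod_type]
  rfl

/-- Lindeberg's replacement argument. -/
theorem lindeberg {M : ℝ} {f f1 f2 : ℝ → ℝ} {B : ℝ}
    (hM : SecondOrderBound M f f1 f2) (hf : Continuous f) (hf1 : Continuous f1)
    (hf2 : Continuous f2) (hB : ∀ x, |f x| ≤ B) (hB1 : ∀ x, |f1 x| ≤ B) (hB2 : ∀ x, |f2 x| ≤ B)
    {I : ℕ} {n : Fin I → ℕ} {p x : UnitVec n}
    (hp : ∀ i, p i ∈ stdSimplex ℝ (Fin (n i))) (hx : ∀ i, ∑ j, p i j * x i j = 0)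
    {v : Fin I → NNReal} (hv : ∀ i, (v i : ℝ) = ∑ j, p i j * x i j ^ 2) (s : ℝ) :
    |∑ a : Assignment n, (∏ i, p i (a i)) * f (s + ∑ i, x i (a i)) -
        ∫ z, f (s + z) ∂gaussianReal 0 (∑ i, v i)| ≤
      M * ∑ i, (∑ j, p i j * |x i j| ^ 3 + (∫ z, |z| ^ 3 ∂gaussianReal 0 1) * √(v i) ^ 3) := by
  induction I generalizing s with
  | zero => simp
  | succ I ih =>
    set K := ∫ z, |z| ^ 3 ∂gaussianReal 0 1
    set V : NNReal := ∑ i : Fin I, v i.succ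
    -- `g` is `f` with all sets but the first already replaced by their Gaussian substitute.
    set g : ℝ → ℝ := fun s => ∫ z, f (s + z) ∂gaussianReal 0 V
    have hgM : SecondOrderBound M g _ _ :=
      secondOrderBound_integral hM hf hf1 hf2 hB hB1 hB2 (gaussianReal 0 V)
    have hconv : gaussianReal 0 (∑ i, v i) = gaussianReal 0 (v 0) ∗ gaussianReal 0 V := by
      rw [gaussianReal_conv_gaussianReal, Fin.sum_univ_succ, add_zero]
    have hgi : ∀ (s : ℝ) (u : NNReal), Integrable (fun z => g (s + z)) (gaussianReal 0 u) := by
      intro s u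
      refine Integrable.of_bound (C := B) ?_ (ae_of_all _ fun z => ?_)
      · refine Continuous.aestronglyMeasurable ?_
        refine continuous_of_dominated (bound := fun _ => B) (fun x => ?_) (fun x => ?_) ?_ ?_
        · exact Continuous.aestronglyMeasurable (by fun_prop)
        · exact ae_of_all _ fun z => hB _
        · exact integrable_const _
        · exact ae_of_all _ fun z => by fun_prop
      · have := norm_integral_le_of_norm_le_const (μ := gaussianReal 0 V)
          (f := fun w => f (s + z + w)) (C := B) (ae_of_all _ fun w => hB _)
        simpa using this
    have hg : ∫ z, f (s + z) ∂gaussianReal 0 (∑ i, v i) = ∫ z, g (s + z) ∂gaussianReal 0 (v 0) := by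
      rw [hconv, integral_conv (integrable_comp_add_of_bounded hf hB s)]
      simp only [g, add_assoc]
    have hrest : ∀ t, |∑ b : ∀ i : Fin I, Fin (n i.succ), (∏ i, p i.succ (b i)) *
        f (t + ∑ i, x i.succ (b i)) - g t| ≤
        M * ∑ i : Fin I, (∑ j, p i.succ j * |x i.succ j| ^ 3 + K * √(v i.succ) ^ 3) := fun t =>
      ih (n := fun i => n i.succ) (p := fun i => p i.succ) (x := fun i => x i.succ)
        (fun i => hp _) (fun i => hx _) (v := fun i => v i.succ) (fun i => hv _) t
    set R := M * ∑ i : Fin I, (∑ j, p i.succ j * |x i.succ j| ^ 3 + K * √(v i.succ) ^ 3)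
    have e1 : ∑ a : Assignment n, (∏ i, p i (a i)) * f (s + ∑ i, x i (a i)) =
        ∑ j, p 0 j * ∑ b : ∀ i : Fin I, Fin (n i.succ), (∏ i, p i.succ (b i)) *
          f (s + x 0 j + ∑ i, x i.succ (b i)) := by
      rw [sum_assignment_succ]
      refine Finset.sum_congr rfl fun j _ => ?_
      rw [Finset.mul_sum]
      refine Finset.sum_congr rfl fun b _ => ?_
      rw [Fin.prod_univ_succ, Fin.sum_univ_succ]
      simp only [Fin.cons_zero, Fin.cons_succ]
      rw [mul_assoc, add_assoc]
    have b1 : |∑ j, p 0 j * (∑ b : ∀ i : Fin I, Fin (n i.succ), (∏ i, p i.succ (b i)) *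
          f (s + x 0 j + ∑ i, x i.succ (b i))) - ∑ j, p 0 j * g (s + x 0 j)| ≤ R := by
      rw [← Finset.sum_sub_distrib]
      calc _ ≤ ∑ j, p 0 j * R := by
            refine (Finset.abs_sum_le_sum_abs _ _).trans (Finset.sum_le_sum fun j _ => ?_)
            rw [← mul_sub, abs_mul, abs_of_nonneg ((hp 0).1 j)]
            exact mul_le_mul_of_nonneg_left (hrest _) ((hp 0).1 j)
        _ = R := by rw [← Finset.sum_mul, (hp 0).2, one_mul]
    -- The first set and its Gaussian substitute have equal mean and variance, so both are compared
    -- with the same second-order expression in `g`.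
    have b2 := abs_sum_sub_le hgM (hp 0) (hx 0) s
    have b3 := abs_integral_gaussianReal_sub_le hgM hgi s (v 0)
    rw [hv 0] at b3
    have hR : M * ∑ i, (∑ j, p i j * |x i j| ^ 3 + K * √(v i) ^ 3) =
        M * ∑ j, p 0 j * |x 0 j| ^ 3 + M * (K * √(v 0) ^ 3) + R := by
      rw [Fin.sum_univ_succ]; ring
    rw [hR, e1, hg]
    rw [← hv 0] at b2 b3
    rw [abs_le] at b1 b2 b3 ⊢
    constructor <;> linarith [b1.1, b1.2, b2.1, b2.2, b3.1, b3.2]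

/-- The standard Gaussian density is at most `1`, so the added interval of length `η` has mass at
most `η`. -/
theorem gaussianReal_Ici_sub_le (c : ℝ) {η : ℝ} (hη : 0 ≤ η) :
    (gaussianReal 0 1).real (Ici (c - η)) ≤ (gaussianReal 0 1).real (Ici c) + η := by
  have h1 : Ici (c - η) ⊆ Ici c ∪ Ico (c - η) c := fun x hx => by
    rcases le_or_gt c x with h | h
    · exact Or.inl h
    · exact Or.inr ⟨hx, h⟩
  refine (measureReal_mono h1).trans ((measureReal_union_le _ _).trans ?_)
  gcongr
  have h2 : ∀ x ∈ Ico (c - η) c, ‖gaussianPDFReal 0 1 x‖ ≤ 1 := by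
    intro x _
    rw [Real.norm_of_nonneg (gaussianPDFReal_nonneg _ _ _), gaussianPDFReal]
    have h3 : (√(2 * Real.pi * ((1 : NNReal) : ℝ)))⁻¹ ≤ 1 := by
      refine inv_le_one_of_one_le₀ (Real.one_le_sqrt.2 ?_)
      have := Real.pi_gt_three
      norm_num
      linarith
    have h4 : Real.exp (-(x - 0) ^ 2 / (2 * ((1 : NNReal) : ℝ))) ≤ 1 := by
      refine Real.exp_le_one_iff.2 (div_nonpos_of_nonpos_of_nonneg ?_ (by positivity))
      nlinarith [sq_nonneg (x - 0)]
    calc _ ≤ (1 : ℝ) * 1 := mul_le_mul h3 h4 (Real.exp_pos _).le zero_le_one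
      _ = 1 := one_mul 1
  rw [measureReal_def, gaussianReal_apply_eq_integral 0 one_ne_zero,
    ENNReal.toReal_ofReal (integral_nonneg fun x => gaussianPDFReal_nonneg _ _ _)]
  have h5 := norm_setIntegral_le_of_norm_le_const (μ := volume) (s := Ico (c - η) c)
    (f := gaussianPDFReal 0 1) (C := 1) (by simp) h2
  have h6 : (volume : Measure ℝ).real (Ico (c - η) c) = η := by
    rw [measureReal_def, Real.volume_Ico, ENNReal.toReal_ofReal (by linarith)]; ring
  rw [h6, one_mul] at h5
  exact (le_abs_self _).trans h5

/-- A one-sided normal approximation for sums of independent bounded variables, uniform over all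
the laws. -/
theorem exists_normal_approximation {ε : ℝ} (hε : 0 < ε) : ∃ δ : ℝ, 0 < δ ∧
    ∀ {I : ℕ} {n : Fin I → ℕ} {p x : UnitVec n}, (∀ i, p i ∈ stdSimplex ℝ (Fin (n i))) →
      (∀ i, ∑ j, p i j * x i j = 0) → (∑ i, ∑ j, p i j * x i j ^ 2 = 1) →
      (∀ i j, |x i j| ≤ δ) → ∀ c : ℝ,
      ∑ a : Assignment n, (if c ≤ ∑ i, x i (a i) then ∏ i, p i (a i) else 0) ≤
        (gaussianReal 0 1).real (Ici c) + ε := by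
  obtain ⟨M, hM0, hM⟩ := exists_smooth_step
  -- Half of `ε` pays for the smoothing width, half for the Lindeberg error. The latter is at most
  -- `L * δ`, as cubes are at most `δ` times squares and the variances sum to `1`; `L + 1` avoids
  -- dividing by zero.
  set η := ε / 2 with hη
  have hη0 : 0 < η := by positivity
  set K := ∫ z, |z| ^ 3 ∂gaussianReal 0 1 with hK
  have hK0 : 0 ≤ K := integral_nonneg fun z => by positivity
  set L := M / η ^ 3 * (1 + K) with hL
  have hL0 : 0 ≤ L := by positivity
  refine ⟨η / (L + 1), by positivity, ?_⟩
  set δ := η / (L + 1) with hδ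
  have hδ0 : 0 < δ := by positivity
  intro I n p x hp hx hx2 hxδ c
  obtain ⟨f, f1, f2, B, hf, hf1, hf2, hB, hB1, hB2, hb, hone, hzero, hnn, hle⟩ := hM η hη0 c
  set v : Fin I → NNReal := fun i => ⟨∑ j, p i j * x i j ^ 2,
    Finset.sum_nonneg fun j _ => mul_nonneg ((hp i).1 j) (sq_nonneg _)⟩
  have hv : ∀ i, (v i : ℝ) = ∑ j, p i j * x i j ^ 2 := fun i => rfl
  have hV : ∑ i, v i = 1 := by
    ext; rw [NNReal.coe_sum]; exact hx2
  have key := lindeberg hb hf hf1 hf2 hB hB1 hB2 hp hx hv 0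
  rw [hV] at key
  have hbd : M / η ^ 3 * ∑ i, (∑ j, p i j * |x i j| ^ 3 + K * √(v i) ^ 3) ≤ η := by
    have h1 : ∀ i, ∑ j, p i j * |x i j| ^ 3 + K * √(v i) ^ 3 ≤ (1 + K) * δ * v i := by
      intro i
      have a1 : ∑ j, p i j * |x i j| ^ 3 ≤ δ * v i := by
        rw [hv, Finset.mul_sum]
        refine Finset.sum_le_sum fun j _ => ?_
        have : |x i j| ^ 3 = |x i j| * x i j ^ 2 := by rw [← sq_abs (x i j)]; ring
        rw [this]
        calc _ = p i j * x i j ^ 2 * |x i j| := by ring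
          _ ≤ p i j * x i j ^ 2 * δ :=
            mul_le_mul_of_nonneg_left (hxδ i j) (mul_nonneg ((hp i).1 j) (sq_nonneg _))
          _ = _ := by ring
      have a2 : √(v i) ≤ δ := by
        refine Real.sqrt_le_iff.2 ⟨hδ0.le, ?_⟩
        rw [hv]
        calc _ ≤ ∑ j, p i j * δ ^ 2 := by
              refine Finset.sum_le_sum fun j _ => mul_le_mul_of_nonneg_left ?_ ((hp i).1 j)
              rw [← sq_abs]; gcongr; exact hxδ i j
          _ = δ ^ 2 := by rw [← Finset.sum_mul, (hp i).2, one_mul]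
      have a3 : √(v i) ^ 3 ≤ δ * v i := by
        calc √(v i) ^ 3 = √(v i) * √(v i) ^ 2 := by ring
          _ = √(v i) * v i := by rw [Real.sq_sqrt (NNReal.coe_nonneg _)]
          _ ≤ δ * v i := mul_le_mul_of_nonneg_right a2 (v i).2
      nlinarith [mul_le_mul_of_nonneg_left a3 hK0]
    calc _ ≤ M / η ^ 3 * ∑ i, (1 + K) * δ * v i :=
          mul_le_mul_of_nonneg_left (Finset.sum_le_sum fun i _ => h1 i) (by positivity)
      _ = L * δ * ∑ i, (v i : ℝ) := by rw [← Finset.mul_sum, hL]; ring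
      _ = L * δ := by rw [← NNReal.coe_sum, hV]; simp
      _ ≤ η := by
        rw [hδ, mul_div_assoc', div_le_iff₀ (by positivity)]; nlinarith
  have h1 : ∑ a : Assignment n, (if c ≤ ∑ i, x i (a i) then ∏ i, p i (a i) else 0) ≤
      ∑ a : Assignment n, (∏ i, p i (a i)) * f (0 + ∑ i, x i (a i)) := by
    refine Finset.sum_le_sum fun a _ => ?_
    have hpn : 0 ≤ ∏ i, p i (a i) := Finset.prod_nonneg fun i _ => (hp i).1 _
    split_ifs with h
    · rw [hone _ (by simpa using h), mul_one]
    · exact mul_nonneg hpn (hnn _)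
  have h2 : ∫ z, f (0 + z) ∂gaussianReal 0 1 ≤ (gaussianReal 0 1).real (Ici (c - η)) := by
    rw [← integral_indicator_one measurableSet_Ici]
    refine integral_mono (integrable_comp_add_of_bounded hf hB 0)
      ((integrable_const 1).indicator measurableSet_Ici) fun z => ?_
    by_cases hz : z ∈ Ici (c - η)
    · simpa [indicator_of_mem hz] using hle z
    · simpa [indicator_of_notMem hz] using (hzero z (not_le.1 hz).le).le
  have h3 := gaussianReal_Ici_sub_le c hη0.le
  have h4 := (abs_le.1 (key.trans hbd)).2
  linarith

/-! ### Comparison of Gaussian tails -/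

/-- The upper tail of the standard Gaussian law. -/
def gaussianTail (x : ℝ) : ℝ := (gaussianReal 0 1).real (Ici x)

theorem gaussianTail_antitone : Antitone gaussianTail := fun _ _ h =>
  measureReal_mono (Ici_subset_Ici.2 h)

theorem gaussianTail_nonneg (x : ℝ) : 0 ≤ gaussianTail x := measureReal_nonneg

theorem gaussianTail_le_one (x : ℝ) : gaussianTail x ≤ 1 := measureReal_le_one

theorem tendsto_gaussianTail : Tendsto gaussianTail atTop (𝓝 0) := by
  -- The shift by `1` places the closed half line at `x` inside the complement of `Iic (x - 1)`.
  have h1 : Tendsto (fun x : ℝ => 1 - cdf (gaussianReal 0 1) (x - 1)) atTop (𝓝 0) := by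
    simpa [sub_eq_add_neg] using ((tendsto_cdf_atTop (gaussianReal 0 1)).comp
      (tendsto_atTop_add_const_right atTop (-1 : ℝ) tendsto_id)).const_sub 1
  refine squeeze_zero gaussianTail_nonneg (fun x => ?_) h1
  rw [cdf_eq_real, ← probReal_compl_eq_one_sub measurableSet_Iic, compl_Iic]
  exact measureReal_mono fun y hy => lt_of_lt_of_le (sub_one_lt x) hy

theorem gaussianReal_Ici_eq {m v c : ℝ} (hv : 0 < v) :
    (gaussianReal m v.toNNReal).real (Ici c) = gaussianTail ((c - m) / √v) := by
  have hs : 0 < √v := Real.sqrt_pos.2 hv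
  have h : gaussianReal m v.toNNReal = (gaussianReal 0 1).map (fun x => m + √v * x) := by
    have h1 : (fun x => m + √v * x) = (fun x => m + x) ∘ (fun x => √v * x) := rfl
    rw [h1, ← Measure.map_map (by fun_prop) (by fun_prop), gaussianReal_map_const_mul,
      gaussianReal_map_const_add]
    congr 1
    · simp
    · ext; simp [hv.le]
  rw [h, map_measureReal_apply (by fun_prop) measurableSet_Ici, gaussianTail]
  congr 1
  ext x
  simp only [mem_preimage, mem_Ici, div_le_iff₀ hs]
  constructor <;> intro h <;> linarith

/-- The upper tail at `c` of a Gaussian law, truncated at its value at the mean. -/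
def truncTail (m v c : ℝ) : ℝ :=
  min (gaussianTail 0) ((gaussianReal m v.toNNReal).real (Ici c))

theorem truncTail_of_pos {m v c : ℝ} (hv : 0 < v) (hc : m ≤ c) :
    truncTail m v c = gaussianTail ((c - m) / √v) := by
  rw [truncTail, gaussianReal_Ici_eq hv, min_eq_right]
  exact gaussianTail_antitone (div_nonneg (by linarith) (Real.sqrt_nonneg _))

/-- This is what the truncation is for: at its mean a point mass has tail `1`, a nondegenerate
Gaussian `gaussianTail 0`. Capping removes the jump, so that zero variances need no separate
treatment later. -/
theorem truncTail_self (m v : ℝ) : truncTail m v m = gaussianTail 0 := by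
  rcases le_or_gt v 0 with hv | hv
  · rw [truncTail, Real.toNNReal_of_nonpos hv, gaussianReal_zero_var, min_eq_left]
    simp [measureReal_def, gaussianTail_le_one]
  · rw [truncTail_of_pos hv le_rfl]; simp

theorem truncTail_of_var_eq_zero {m c : ℝ} (hc : m < c) : truncTail m 0 c = 0 := by
  rw [truncTail, Real.toNNReal_zero, gaussianReal_zero_var, min_eq_right]
  · simp [measureReal_def, hc]
  · simp [measureReal_def, hc, gaussianTail_nonneg]

theorem truncTail_mono {m v v' c : ℝ} (hc : m ≤ c) (hv : 0 ≤ v) (hvv : v ≤ v') :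
    truncTail m v c ≤ truncTail m v' c := by
  rcases hc.eq_or_lt with rfl | hc
  · rw [truncTail_self, truncTail_self]
  rcases hv.eq_or_lt with rfl | hv
  · rw [truncTail_of_var_eq_zero hc]
    exact le_min (gaussianTail_nonneg _) measureReal_nonneg
  · rw [truncTail_of_pos hv hc.le, truncTail_of_pos (hv.trans_le hvv) hc.le]
    refine gaussianTail_antitone ?_
    have := Real.sqrt_pos.2 hv
    gcongr

/-- If the excess of the first variance is small compared with the excess of the second mean, the
first tail exceeds the second at most far out. -/
theorem truncTail_le_max {m₁ m₂ v₁ v₂ c C : ℝ} (hm : m₁ ≤ m₂) (hc : m₂ ≤ c) (h₁ : 0 ≤ v₁)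
    (h₂ : 0 ≤ v₂) (hC : 0 ≤ C) (h : C * (v₁ - v₂) ≤ (m₂ - m₁) * √v₁) :
    truncTail m₁ v₁ c ≤ max (truncTail m₂ v₂ c) (gaussianTail (C / 2)) := by
  rcases h₁.eq_or_lt with rfl | h₁
  · refine le_max_of_le_left ?_
    rcases hc.eq_or_lt with rfl | hc
    · rw [truncTail_self]; exact min_le_left _ _
    · rw [truncTail_of_var_eq_zero (by linarith)]
      exact le_min (gaussianTail_nonneg _) measureReal_nonneg
  rw [truncTail_of_pos h₁ (hm.trans hc)]
  have hs₁ := Real.sqrt_pos.2 h₁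
  set s := √v₁ with hs
  have hss : v₁ = s ^ 2 := (Real.sq_sqrt h₁.le).symm
  rcases le_or_gt v₁ v₂ with hv | hv
  · refine le_max_of_le_left ?_
    rw [truncTail_of_pos (h₁.trans_le hv) hc]
    refine gaussianTail_antitone ?_
    have := Real.sqrt_le_sqrt hv
    have h0 : 0 ≤ c - m₁ := by linarith
    gcongr
  set r := √v₂ with hr
  have hr0 : 0 ≤ r := Real.sqrt_nonneg _
  have hrr : v₂ = r ^ 2 := (Real.sq_sqrt h₂).symm
  have hrs : r < s := Real.sqrt_lt_sqrt h₂ hv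
  rw [hss, hrr] at h
  -- If `c` is at least `C / 2` standard deviations out, the second term of the maximum suffices.
  -- Otherwise `c - m₁ < C * s / 2`, and the standardized distances can be compared directly.
  by_cases hfar : C / 2 ≤ (c - m₁) / s
  · exact le_max_of_le_right (gaussianTail_antitone hfar)
  rw [not_le, div_lt_iff₀ hs₁] at hfar
  refine le_max_of_le_left ?_
  -- If `r ≤ s / 2`, the variance drop is at least `3 / 4 * s ^ 2`, forcing `m₂ - m₁ ≥ 3 / 4 * C *
  -- s`, too much for `m₂ ≤ c`.
  have hr1 : s / 2 < r := by
    by_contra hcon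
    rw [not_lt] at hcon
    have h3 : C * (3 / 4 * s ^ 2) ≤ C * (s ^ 2 - r ^ 2) :=
      mul_le_mul_of_nonneg_left (by nlinarith) hC
    have h4 : C * (3 / 4 * s) ≤ m₂ - m₁ := by
      have : C * (3 / 4 * s) * s ≤ (m₂ - m₁) * s := by nlinarith
      exact le_of_mul_le_mul_right this hs₁
    nlinarith [mul_nonneg hC hs₁.le]
  have hrp : 0 < r := by linarith
  rw [truncTail_of_pos (by rw [hrr]; positivity) hc]
  refine gaussianTail_antitone ?_
  rw [← hr, div_le_div_iff₀ hrp hs₁]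
  -- The reverse inequality gives `(m₂ - m₁) * s < (c - m₁) * (s - r)`; cancelling `s - r` yields `C
  -- * (s + r) < c - m₁`, against `c - m₁ < C * s / 2`.
  by_contra hcon
  rw [not_le] at hcon
  have h5 : C * (s + r) * (s - r) ≤ (m₂ - m₁) * s := by nlinarith
  have h6 : (m₂ - m₁) * s < (c - m₁) * (s - r) := by nlinarith
  have h7 : C * (s + r) < c - m₁ := lt_of_mul_lt_mul_right (h5.trans_lt h6) (by linarith)
  nlinarith [mul_nonneg hC hs₁.le, mul_nonneg hC hrp.le]

/-! ### Extremal means and variances of a single set -/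

section SingleSet

variable {m : ℕ} {p q : Fin m → ℝ} {G : EReal}

theorem pos_of_mem_stdSimplex (hp : p ∈ stdSimplex ℝ (Fin m)) : 0 < m := by
  rcases Nat.eq_zero_or_pos m with rfl | h
  · simpa using hp.2
  · exact h

theorem one_le_bias (hp : p ∈ stdSimplex ℝ (Fin m)) : 1 ≤ bias p := by
  have : Nonempty (Fin m) := ⟨⟨0, pos_of_mem_stdSimplex hp⟩⟩
  have h1 : (⨅ j, ENNReal.ofReal (p j)) ≤ ⨆ j, ENNReal.ofReal (p j) := iInf_le_iSup
  have h2 : (⨆ j, ENNReal.ofReal (p j)) ≠ 0 := by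
    intro h
    have h1 : ∀ j, p j = 0 := fun j => le_antisymm
      (ENNReal.ofReal_eq_zero.1 (le_antisymm (h ▸ le_iSup (fun j => ENNReal.ofReal (p j)) j)
        bot_le)) (hp.1 j)
    have h2 := hp.2
    simp [h1] at h2
  have h3 : (⨆ j, ENNReal.ofReal (p j)) ≠ ⊤ := by
    obtain ⟨j, hj⟩ := exists_eq_ciSup_of_finite (f := fun j => ENNReal.ofReal (p j))
    rw [← hj]; exact ENNReal.ofReal_ne_top
  have h4 : (1 : ℝ≥0∞) ≤ (⨆ j, ENNReal.ofReal (p j)) / ⨅ j, ENNReal.ofReal (p j) := by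
    rw [ENNReal.le_div_iff_mul_le (Or.inr h2) (Or.inr h3), one_mul]
    exact h1
  rw [bias]
  exact_mod_cast h4

theorem abs_mean_le (hp : p ∈ stdSimplex ℝ (Fin m)) (q : Fin m → ℝ) :
    |mean p q| ≤ ∑ j, |q j| := by
  refine (Finset.abs_sum_le_sum_abs _ _).trans (Finset.sum_le_sum fun j _ => ?_)
  rw [abs_mul, abs_of_nonneg (hp.1 j)]
  have h1 : p j ≤ 1 := hp.2 ▸ Finset.single_le_sum (fun i _ => hp.1 i) (Finset.mem_univ j)
  exact mul_le_of_le_one_left (abs_nonneg _) h1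

theorem mean_le_maxMean (hp : p ∈ stdSimplex ℝ (Fin m)) (q : Fin m → ℝ) (hG : bias p ≤ G) :
    mean p q ≤ maxMean q G := by
  refine le_csSup ⟨∑ j, |q j|, ?_⟩ ⟨p, hp, hG, rfl⟩
  rintro _ ⟨p', hp', -, rfl⟩
  exact (le_abs_self _).trans (abs_mean_le hp' q)

theorem var_nonneg (hp : p ∈ stdSimplex ℝ (Fin m)) (q : Fin m → ℝ) : 0 ≤ var p q :=
  Finset.sum_nonneg fun j _ => mul_nonneg (hp.1 j) (sq_nonneg _)

theorem var_le_maxVar (hp : p ∈ stdSimplex ℝ (Fin m)) (hG : bias p ≤ G)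
    (hm : mean p q = maxMean q G) : var p q ≤ maxVar q G := by
  refine le_csSup ⟨(2 * ∑ j, |q j|) ^ 2, ?_⟩ ⟨p, hp, hG, hm, rfl⟩
  rintro _ ⟨p', hp', -, -, rfl⟩
  have h1 : ∀ j, (q j - mean p' q) ^ 2 ≤ (2 * ∑ j, |q j|) ^ 2 := by
    intro j
    rw [← sq_abs]
    have h2 : |q j| ≤ ∑ j, |q j| :=
      Finset.single_le_sum (f := fun j => |q j|) (fun i _ => abs_nonneg _) (Finset.mem_univ j)
    have h3 := abs_mean_le hp' q
    have h4 := abs_sub (q j) (mean p' q)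
    gcongr
    linarith
  calc var p' q ≤ ∑ j, p' j * (2 * ∑ j, |q j|) ^ 2 :=
        Finset.sum_le_sum fun j _ => mul_le_mul_of_nonneg_left (h1 j) (hp'.1 j)
    _ = (2 * ∑ j, |q j|) ^ 2 := by rw [← Finset.sum_mul, hp'.2, one_mul]

theorem maxVar_nonneg (q : Fin m → ℝ) (G : EReal) : 0 ≤ maxVar q G := by
  refine Real.sSup_nonneg ?_
  rintro _ ⟨p, hp, -, -, rfl⟩
  exact var_nonneg hp q

theorem eq_top_or_exists_coe_of_one_le (hG : 1 ≤ G) : G = ⊤ ∨ ∃ g : ℝ, 1 ≤ g ∧ G = (g : EReal) := by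
  induction G with
  | bot => exact absurd hG (not_le.2 (EReal.bot_lt_coe 1))
  | top => exact Or.inl rfl
  | coe g => exact Or.inr ⟨g, by exact_mod_cast hG, rfl⟩

theorem uniform_mem_stdSimplex (hm : 0 < m) : (fun _ => (m : ℝ)⁻¹) ∈ stdSimplex ℝ (Fin m) :=
  ⟨fun _ => by positivity, by simp [hm.ne']⟩

/-- The admissible laws form a compact set, which contains the uniform law because `1 ≤ G`; the mean
is continuous on it. -/
theorem exists_mean_eq_maxMean (hm : 0 < m) (q : Fin m → ℝ) (hG : 1 ≤ G) :
    ∃ p ∈ stdSimplex ℝ (Fin m), bias p ≤ G ∧ mean p q = maxMean q G := by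
  have hK : IsCompact {p | p ∈ stdSimplex ℝ (Fin m) ∧ bias p ≤ G} := by
    rcases eq_top_or_exists_coe_of_one_le hG with rfl | ⟨g, hg, rfl⟩
    · simpa using isCompact_stdSimplex ℝ (Fin m)
    · have : {p | p ∈ stdSimplex ℝ (Fin m) ∧ bias p ≤ (g : EReal)} =
          stdSimplex ℝ (Fin m) ∩ ⋂ j, ⋂ l, {p | p j ≤ g * p l} := by
        ext p
        simp only [mem_ofPred_eq, mem_inter_iff, mem_iInter]
        exact and_congr_right fun hp => bias_le_coe_iff hp hg
      rw [this]
      exact (isCompact_stdSimplex ℝ (Fin m)).inter_right (isClosed_iInter fun j =>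
        isClosed_iInter fun l => isClosed_le (by fun_prop) (by fun_prop))
  have hne : {p | p ∈ stdSimplex ℝ (Fin m) ∧ bias p ≤ G}.Nonempty := by
    have hu := uniform_mem_stdSimplex hm
    have hb : bias (fun _ : Fin m => (m : ℝ)⁻¹) ≤ ((1 : ℝ) : EReal) := by
      rw [bias_le_coe_iff hu le_rfl]; simp
    exact ⟨_, hu, hb.trans hG⟩
  obtain ⟨p, ⟨hp, hpG⟩, hmax⟩ := hK.exists_isMaxOn hne (f := fun p => mean p q)
    (by unfold mean; fun_prop)
  refine ⟨p, hp, hpG, le_antisymm (mean_le_maxMean hp q hpG) (csSup_le ⟨_, p, hp, hpG, rfl⟩ ?_)⟩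
  rintro _ ⟨p', hp', hp'G, rfl⟩
  exact hmax ⟨hp', hp'G⟩

/-- Without a bias bound, a law of maximal mean charges only units of maximal score. Hence only the
sets in `J` contribute to `varOn`. -/
theorem maxVar_top (q : Fin m → ℝ) : maxVar q ⊤ = 0 := by
  refine le_antisymm (Real.sSup_le ?_ le_rfl) (maxVar_nonneg q ⊤)
  rintro _ ⟨p, hp, -, hpm, rfl⟩
  have hle : ∀ j, q j ≤ maxMean q ⊤ := fun j => by
    have h := mean_le_maxMean (single_mem_stdSimplex ℝ j) q (le_top (a := bias _))
    simpa [mean, Pi.single_apply] using h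
  have h0 : ∑ j, p j * (maxMean q ⊤ - q j) = 0 := by
    simp only [mul_sub, Finset.sum_sub_distrib, ← Finset.sum_mul, hp.2, one_mul]
    rw [← hpm]; simp [mean]
  rw [Finset.sum_eq_zero_iff_of_nonneg fun j _ =>
    mul_nonneg (hp.1 j) (sub_nonneg.2 (hle j))] at h0
  refine (Finset.sum_eq_zero fun j hj => ?_).le
  rw [hpm]
  linear_combination (maxMean q ⊤ - q j) * h0 j hj

theorem abs_sub_mean_le_scoreRange (hp : p ∈ stdSimplex ℝ (Fin m)) (q : Fin m → ℝ) (j : Fin m) :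
    |q j - mean p q| ≤ scoreRange q := by
  have hu : ∀ l, q l ≤ ⨆ j, q j := le_ciSup (finite_range q).bddAbove
  have hl : ∀ l, ⨅ j, q j ≤ q l := ciInf_le (finite_range q).bddBelow
  have h1 : mean p q ≤ ⨆ j, q j := by
    calc mean p q ≤ ∑ l, p l * ⨆ j, q j :=
          Finset.sum_le_sum fun l _ => mul_le_mul_of_nonneg_left (hu l) (hp.1 l)
      _ = _ := by rw [← Finset.sum_mul, hp.2, one_mul]
  have h2 : ⨅ j, q j ≤ mean p q := by
    calc _ = ∑ l, p l * ⨅ j, q j := by rw [← Finset.sum_mul, hp.2, one_mul]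
      _ ≤ _ := Finset.sum_le_sum fun l _ => mul_le_mul_of_nonneg_left (hl l) (hp.1 l)
  rw [abs_le, scoreRange]
  constructor <;> linarith [hu j, hl j]

/-- A bias of at most `g` gives every unit probability at least `t = 1 / (m * g)`. The units with
the largest and the smallest score alone contribute at least `t / 2` times the squared range, and `t
^ 3 ≤ t / 2` because `t ≤ 1 / 2`. -/
theorem scaledRange_le_var (hm : 2 ≤ m) (hp : p ∈ stdSimplex ℝ (Fin m)) (q : Fin m → ℝ)
    (hpG : bias p ≤ G) : scaledRange q G ≤ var p q := by
  rcases eq_top_or_exists_coe_of_one_le ((one_le_bias hp).trans hpG) with rfl | ⟨g, hg, rfl⟩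
  · simpa [scaledRange] using var_nonneg hp q
  have : Nonempty (Fin m) := ⟨⟨0, pos_of_mem_stdSimplex hp⟩⟩
  rw [scaledRange, if_neg (EReal.coe_ne_top g), EReal.toReal_coe]
  rw [bias_le_coe_iff hp hg] at hpG
  have hm2 : (2 : ℝ) ≤ m := by exact_mod_cast hm
  have hmg : 2 ≤ m * g := by nlinarith
  set t := (m * g)⁻¹ with ht
  have ht0 : 0 < t := by positivity
  have ht2 : t ≤ 1 / 2 := by rw [ht, one_div]; exact inv_anti₀ (by norm_num) hmg
  have hpt : ∀ l, t ≤ p l := by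
    intro l
    have h1 : ∑ j, p j ≤ ∑ _j : Fin m, g * p l := Finset.sum_le_sum fun j _ => hpG j l
    rw [hp.2] at h1
    simp only [Finset.sum_const, Finset.card_univ, Fintype.card_fin, nsmul_eq_mul] at h1
    rw [ht, inv_le_iff_one_le_mul₀ (by positivity)]
    linarith
  obtain ⟨a, ha⟩ := exists_eq_ciSup_of_finite (f := q)
  obtain ⟨b, hb⟩ := exists_eq_ciInf_of_finite (f := q)
  rw [scoreRange, ← ha, ← hb, div_eq_mul_inv, ← inv_pow, ← ht]
  by_cases hab : a = b
  · rw [hab]; simpa using var_nonneg hp q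
  have h2 : ∑ j ∈ {a, b}, p j * (q j - mean p q) ^ 2 ≤ var p q :=
    Finset.sum_le_sum_of_subset_of_nonneg (Finset.subset_univ _) fun j _ _ =>
      mul_nonneg (hp.1 j) (sq_nonneg _)
  rw [Finset.sum_pair hab] at h2
  have h3 := mul_le_mul_of_nonneg_right (hpt a) (sq_nonneg (q a - mean p q))
  have h4 := mul_le_mul_of_nonneg_right (hpt b) (sq_nonneg (q b - mean p q))
  have h5 : (q a - q b) ^ 2 ≤ 2 * ((q a - mean p q) ^ 2 + (q b - mean p q) ^ 2) := by
    nlinarith [sq_nonneg ((q a - mean p q) + (q b - mean p q))]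
  have h6 : t ^ 3 ≤ t / 2 := by
    have : t ^ 2 ≤ 1 / 2 := by nlinarith
    nlinarith
  calc (q a - q b) ^ 2 * t ^ 3 ≤ (q a - q b) ^ 2 * (t / 2) := by gcongr
    _ ≤ (2 * ((q a - mean p q) ^ 2 + (q b - mean p q) ^ 2)) * (t / 2) := by gcongr
    _ ≤ _ := by linarith

theorem scaledRange_le_maxVar (hm : 2 ≤ m) (q : Fin m → ℝ) (hG : 1 ≤ G) :
    scaledRange q G ≤ maxVar q G := by
  obtain ⟨p, hp, hpG, hpm⟩ := exists_mean_eq_maxMean (by omega) q hG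
  exact (scaledRange_le_var hm hp q hpG).trans (var_le_maxVar hp hpG hpm)

theorem scaledRange_nonneg (q : Fin m → ℝ) (hG : 0 ≤ G) : 0 ≤ scaledRange q G := by
  unfold scaledRange
  split_ifs
  · exact le_rfl
  · have := EReal.toReal_nonneg hG
    positivity

theorem var_eq_sum_sq_div (s : ℝ) :
    ∑ j, p j * ((q j - mean p q) / s) ^ 2 = var p q / s ^ 2 := by
  rw [var, Finset.sum_div]
  exact Finset.sum_congr rfl fun j _ => by rw [div_pow]; ring

end SingleSet

/-! ### Sums over sets of ranks -/

section Ranks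

variable {I : ℕ} {n : Fin I → ℕ} {w : UnitVec n} {G : EReal} {k : ℕ} {J J' : Finset (Fin I)}

theorem muOn_eq (w : UnitVec n) (G : EReal) (J : Finset (Fin I)) :
    muOn w G J = ∑ i, maxMean (w i) ⊤ - ∑ i ∈ J, meanGap (w i) G := by
  have h : ∑ i ∈ J, meanGap (w i) G = ∑ i, if i ∈ J then meanGap (w i) G else 0 := by simp
  rw [h, ← Finset.sum_sub_distrib]
  refine Finset.sum_congr rfl fun i _ => ?_
  by_cases hi : i ∈ J <;> simp [partialBound, hi, meanGap]

theorem varOn_eq (w : UnitVec n) (G : EReal) (J : Finset (Fin I)) :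
    varOn w G J = ∑ i ∈ J, maxVar (w i) G := by
  have h : ∑ i ∈ J, maxVar (w i) G = ∑ i, if i ∈ J then maxVar (w i) G else 0 := by simp
  rw [h]
  refine Finset.sum_congr rfl fun i _ => ?_
  by_cases hi : i ∈ J <;> simp [partialBound, hi, maxVar_top]

theorem varOn_nonneg (w : UnitVec n) (G : EReal) (J : Finset (Fin I)) : 0 ≤ varOn w G J :=
  Finset.sum_nonneg fun _ _ => maxVar_nonneg _ _

/-- The difference of two sums with equally many terms, as a sum over pairs. -/
theorem card_sdiff_mul_sum_sub {ι : Type*} [DecidableEq ι] {J J' : Finset ι}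
    (h : J.card = J'.card) (f : ι → ℝ) :
    ((J \ J').card : ℝ) * (∑ j ∈ J', f j - ∑ i ∈ J, f i) =
      ∑ x ∈ (J \ J') ×ˢ (J' \ J), (f x.2 - f x.1) := by
  have hc : (J' \ J).card = (J \ J').card := (Finset.card_sdiff_comm h).symm
  have h1 : ∑ j ∈ J', f j - ∑ i ∈ J, f i = ∑ j ∈ J' \ J, f j - ∑ i ∈ J \ J', f i := by
    rw [← Finset.sum_inter_add_sum_sdiff J' J, ← Finset.sum_inter_add_sum_sdiff J J',
      Finset.inter_comm]
    ring
  rw [h1, Finset.sum_product]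
  simp only [Finset.sum_sub_distrib, Finset.sum_const, nsmul_eq_mul, hc, ← Finset.mul_sum]
  ring

theorem IsRankSet.meanGap_le (h : IsRankSet w G k J) {i j : Fin I} (hi : i ∈ J) (hj : j ∉ J) :
    meanGap (w i) G ≤ meanGap (w j) G := by
  rcases h.2 i hi j hj with h | h
  exacts [h.le, h.1.le]

/-- By `muOn_eq`, maximizing the mean means minimizing the sum of the gaps. Exchanging members of a
rank set for outsiders never lowers that sum. -/
theorem IsRankSet.muOn_le (h : IsRankSet w G k J) (hJ' : J'.card = k) :
    muOn w G J' ≤ muOn w G J := by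
  rw [muOn_eq, muOn_eq]
  have hcard : J.card = J'.card := h.1.trans hJ'.symm
  rcases Finset.eq_empty_or_nonempty (J \ J') with he | he
  · rw [Finset.eq_of_subset_of_card_le (Finset.sdiff_eq_empty_iff_subset.1 he) hcard.ge]
  have hpos : (0 : ℝ) < (J \ J').card := by exact_mod_cast he.card_pos
  have hsum : 0 ≤ ((J \ J').card : ℝ) *
      (∑ j ∈ J', meanGap (w j) G - ∑ i ∈ J, meanGap (w i) G) := by
    rw [card_sdiff_mul_sum_sub hcard]
    refine Finset.sum_nonneg fun x hx => ?_
    simp only [Finset.mem_product, Finset.mem_sdiff] at hx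
    exact sub_nonneg.2 (h.meanGap_le hx.1.1 hx.2.2)
  linarith [nonneg_of_mul_nonneg_right hsum hpos]

theorem IsRankSet.muRank_eq (h : IsRankSet w G k J) : muRank w G k = muOn w G J := by
  refine IsGreatest.csSup_eq ⟨⟨J, h.1, rfl⟩, ?_⟩
  rintro _ ⟨J', hJ', rfl⟩
  exact h.muOn_le hJ'

theorem IsRankSet.varOn_le_varRank (h : IsRankSet w G k J) : varOn w G J ≤ varRank w G k := by
  refine le_csSup ((Set.toFinite (range (varOn w G))).subset ?_).bddAbove
    ⟨J, h.1, h.muRank_eq.symm, rfl⟩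
  rintro _ ⟨J', -, -, rfl⟩
  exact ⟨J', rfl⟩

/-- This is the hypothesis of `truncTail_le_max` for the passage from `J'` to `J`. Times the size of
`J \ J'`, both differences become sums over exchanged pairs. Restricting to `swaps` can only raise
the variance sum and lower the mean sum, whose terms are nonnegative; the ratio of the remaining
sums is the ratio of averages in `swapRatio`. -/
theorem IsRankSet.mul_varOn_sub_le (h : IsRankSet w G k J) (hn : ∀ i, 2 ≤ n i) (hG : 1 ≤ G)
    (hJ' : J'.card = k) {C : ℝ} (hC : (C : EReal) ≤ swapRatio w G J' J) (hC0 : 0 ≤ C) :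
    C * (varOn w G J' - varOn w G J) ≤ (muOn w G J - muOn w G J') * √(varOn w G J') := by
  have hcard : J.card = J'.card := h.1.trans hJ'.symm
  rcases Finset.eq_empty_or_nonempty (J \ J') with he | he
  · rw [Finset.eq_of_subset_of_card_le (Finset.sdiff_eq_empty_iff_subset.1 he) hcard.ge]
    simp
  have hpos : (0 : ℝ) < (J \ J').card := by exact_mod_cast he.card_pos
  have hmu : muOn w G J - muOn w G J' =
      ∑ j ∈ J', meanGap (w j) G - ∑ i ∈ J, meanGap (w i) G := by
    rw [muOn_eq, muOn_eq]; ring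
  rw [hmu, varOn_eq w G J]
  conv_lhs => rw [varOn_eq]
  refine le_of_mul_le_mul_left ?_ hpos
  rw [mul_left_comm, ← mul_assoc ((J \ J').card : ℝ), card_sdiff_mul_sum_sub hcard,
    card_sdiff_mul_sum_sub hcard]
  have hgap : ∀ x ∈ (J \ J') ×ˢ (J' \ J), 0 ≤ meanGap (w x.2) G - meanGap (w x.1) G := by
    intro x hx
    simp only [Finset.mem_product, Finset.mem_sdiff] at hx
    exact sub_nonneg.2 (h.meanGap_le hx.1.1 hx.2.2)
  have hV : ∑ x ∈ (J \ J') ×ˢ (J' \ J), (maxVar (w x.2) G - maxVar (w x.1) G) ≤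
      ∑ x ∈ swaps w G J' J, (maxVar (w x.2) G - maxVar (w x.1) G) := by
    rw [swaps, Finset.sum_filter]
    refine Finset.sum_le_sum fun x _ => ?_
    split_ifs with hx <;> linarith
  have hM : ∑ x ∈ swaps w G J' J, (meanGap (w x.2) G - meanGap (w x.1) G) ≤
      ∑ x ∈ (J \ J') ×ˢ (J' \ J), (meanGap (w x.2) G - meanGap (w x.1) G) :=
    Finset.sum_le_sum_of_subset_of_nonneg (Finset.filter_subset _ _) fun x hx _ => hgap x hx
  rcases Finset.eq_empty_or_nonempty (swaps w G J' J) with hs | hs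
  · rw [hs, Finset.sum_empty] at hV
    exact (mul_nonpos_of_nonneg_of_nonpos hC0 hV).trans
      (mul_nonneg (Finset.sum_nonneg hgap) (Real.sqrt_nonneg _))
  rw [swapRatio, if_neg hs.ne_empty, EReal.coe_le_coe_iff, swapMean, swapVar] at hC
  have hN : (0 : ℝ) < (swaps w G J' J).card := by exact_mod_cast hs.card_pos
  have hD : 0 < ∑ x ∈ swaps w G J' J, (maxVar (w x.2) G - maxVar (w x.1) G) :=
    Finset.sum_pos (fun x hx => sub_pos.2 (Finset.mem_filter.1 hx).2) hs
  rw [mul_div_mul_left _ _ (inv_pos.2 hN).ne', div_mul_eq_mul_div, le_div_iff₀ hD] at hC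
  have hroot : √(∑ i ∈ J', scaledRange (w i) G) ≤ √(varOn w G J') := by
    rw [varOn_eq]
    exact Real.sqrt_le_sqrt (Finset.sum_le_sum fun i _ => scaledRange_le_maxVar (hn i) _ hG)
  calc _ ≤ C * ∑ x ∈ swaps w G J' J, (maxVar (w x.2) G - maxVar (w x.1) G) :=
        mul_le_mul_of_nonneg_left hV hC0
    _ ≤ _ := hC
    _ ≤ _ := mul_le_mul hM hroot (Real.sqrt_nonneg _) (Finset.sum_nonneg hgap)

/-- The infimum is attained: if fewer than `k` coordinates are at most `G`, the smallest coordinate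
above `G` bounds `orderStat v k` from below. -/
theorem le_card_of_orderStat_le {v : Fin I → EReal} (hk : k ≤ I) (h : orderStat v k ≤ G) :
    k ≤ (Finset.univ.filter fun i => v i ≤ G).card := by
  by_contra hcon
  rw [not_le] at hcon
  have hne : (Finset.univ.filter fun i => G < v i).Nonempty := by
    rw [Finset.filter_nonempty_iff]
    by_contra hall
    push Not at hall
    rw [Finset.filter_true_of_mem hall] at hcon
    simp at hcon
    omega
  obtain ⟨i, hi, hmin⟩ := Finset.exists_min_image _ v hne
  have hGi : G < v i := (Finset.mem_filter.1 hi).2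
  have h1 : v i ≤ orderStat v k := by
    refine le_sInf fun x hx => ?_
    by_contra hxi
    rw [not_le] at hxi
    refine absurd hx (not_le.2 (lt_of_le_of_lt (Finset.card_le_card fun j hj => ?_) hcon))
    simp only [Finset.mem_filter, Finset.mem_univ, true_and] at hj ⊢
    by_contra hj2
    exact absurd (hmin j (by simpa using hj2)) (not_le.2 (hj.trans_lt hxi))
  exact absurd (h1.trans h) (not_le.2 hGi)

theorem orderStat_le_iff {v : Fin I → EReal} (hk : k ≤ I) :
    orderStat v k ≤ G ↔ k ≤ (Finset.univ.filter fun i => v i ≤ G).card :=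
  ⟨le_card_of_orderStat_le hk, fun h => sInf_le h⟩

/-- If a member of `J` exceeded `G`, all coordinates at most `G` would have indices in `J` minus
that member, hence number fewer than `k`. -/
theorem IsSmallestSet.le_of_orderStat_le {v : Fin I → EReal} (hJ : IsSmallestSet v k J)
    (h : orderStat v k ≤ G) {i : Fin I} (hi : i ∈ J) : v i ≤ G := by
  have hk : k ≤ I := by simpa [hJ.1] using Finset.card_le_univ J
  have h1 := le_card_of_orderStat_le hk h
  by_contra hcon
  rw [not_le] at hcon
  have h2 : (Finset.univ.filter fun i => v i ≤ G) ⊂ J := by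
    rw [Finset.ssubset_iff_of_subset]
    · exact ⟨i, hi, by simpa using hcon⟩
    · intro j hj
      by_contra hjJ
      have := (hJ.2 i hi j hjJ).trans (Finset.mem_filter.1 hj).2
      exact absurd this (not_le.2 hcon)
  have h3 := Finset.card_lt_card h2
  rw [hJ.1] at h3
  omega

end Ranks

/-! ### Probabilities under the assignment mechanism -/

namespace Study

variable {I : ℕ} (S : Study I) {E F : Set (Assignment S.n)}

theorem prod_nonneg (a : Assignment S.n) : 0 ≤ ∏ i, S.p i (a i) :=
  Finset.prod_nonneg fun i _ => (S.p_mem i).1 _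

theorem prob_mono (h : E ⊆ F) : S.prob E ≤ S.prob F :=
  Finset.sum_le_sum fun a _ => indicator_le_indicator_of_subset h (fun a => S.prod_nonneg a) a

theorem prob_univ : S.prob univ = 1 := by
  have h := Finset.prod_univ_sum (fun i => (Finset.univ : Finset (Fin (S.n i)))) S.p
  rw [Fintype.piFinset_univ] at h
  simp only [prob, indicator_univ]
  rw [← h]
  exact Finset.prod_eq_one fun i _ => (S.p_mem i).2

theorem prob_le_one (E : Set (Assignment S.n)) : S.prob E ≤ 1 :=
  S.prob_univ ▸ S.prob_mono (subset_univ E)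

theorem prob_add_prob_compl (E : Set (Assignment S.n)) : S.prob E + S.prob Eᶜ = 1 := by
  rw [← S.prob_univ, prob, prob, prob, ← Finset.sum_add_distrib]
  refine Finset.sum_congr rfl fun a _ => ?_
  rw [← Pi.add_apply, indicator_self_add_compl, indicator_univ]

theorem prob_union_le (E F : Set (Assignment S.n)) : S.prob (E ∪ F) ≤ S.prob E + S.prob F := by
  rw [prob, prob, prob, ← Finset.sum_add_distrib]
  refine Finset.sum_le_sum fun a _ => ?_
  have := S.prod_nonneg a
  by_cases h1 : a ∈ E <;> by_cases h2 : a ∈ F <;> simp [h1, h2, this]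

theorem prob_empty : S.prob ∅ = 0 := by simp [prob]

/-- The upper tail probability of a statistic at its realized value is stochastically at least
uniform. -/
theorem prob_tail_le (h : Assignment S.n → ℝ) {β : ℝ} (hβ : 0 ≤ β) :
    S.prob {a | S.prob {b | h a ≤ h b} ≤ β} ≤ β := by
  rcases eq_empty_or_nonempty {a | S.prob {b | h a ≤ h b} ≤ β} with he | hne
  · rw [he, prob_empty]; exact hβ
  -- The event lies in the upper tail at its own member of smallest `h`, and that tail is at most
  -- `β` by membership.
  obtain ⟨a, ha, hmin⟩ := Set.exists_min_image _ h (toFinite _) hne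
  exact (S.prob_mono fun b hb => hmin b hb).trans ha

end Study

theorem stat_eq {I : ℕ} {n : Fin I → ℕ} (q : UnitVec n → UnitVec n) (a : Assignment n)
    (y : UnitVec n) : stat q a y = ∑ i, q y i (a i) := by
  simp [stat, indicators]

/-! ### Bounded null hypotheses and observed outcomes -/

/-- The frozen scores change with `a`, so their tails cannot be fed to `Study.prob_tail_le`; `h` is
a substitute that does not change with `a`. -/
theorem Study.exists_score_of_boundedNull {I : ℕ} (S : Study I) (hnull : S.BoundedNull)
    {q : UnitVec S.n → UnitVec S.n}
    (hq : EffectIncreasing (stat q) ∨ DifferentialIncreasing (stat q)) :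
    ∃ h : Assignment S.n → ℝ, ∀ a b, h a ≤ h b →
      stat q a (S.Yobs a) ≤ stat q b (S.Yobs a) := by
  have hle : ∀ i j, S.Y1 i j ≤ S.Y0 i j := hnull
  rcases hq with hq | hq
  · refine ⟨fun a => stat q a (S.Yobs a), fun a b hab => hab.trans ?_⟩
    -- Passing from the outcomes observed under `b` to those under `a` raises, weakly, the outcomes
    -- of the units treated by `b` and lowers the others, since `Y1 ≤ Y0`.
    have h := hq b (S.Yobs b) (indicators b * (S.Yobs a - S.Yobs b))
      ((1 - indicators b) * (S.Yobs a - S.Yobs b)) ?_ ?_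
    · have e : S.Yobs b + indicators b * (indicators b * (S.Yobs a - S.Yobs b)) +
          (1 - indicators b) * ((1 - indicators b) * (S.Yobs a - S.Yobs b)) = S.Yobs a := by
        funext i j
        simp only [Pi.add_apply, Pi.mul_apply, Pi.sub_apply, Pi.one_apply, indicators]
        split_ifs <;> ring
      rwa [e] at h
    · intro i j
      have := hle i j
      simp only [Study.Yobs, Pi.add_apply, Pi.mul_apply, Pi.sub_apply, Pi.one_apply, Pi.zero_apply,
        indicators]
      split_ifs <;> linarith
    · intro i j
      have := hle i j
      simp only [Study.Yobs, Pi.add_apply, Pi.mul_apply, Pi.sub_apply, Pi.one_apply, Pi.zero_apply,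
        indicators]
      split_ifs <;> linarith
  · refine ⟨fun a => stat q a S.Y0, fun a b hab => ?_⟩
    -- Adding `Y0 - Y1` on the units treated by `a` restores `Y0`. This raises the statistic at `a`
    -- by at least as much as at `b`, so the ordering at `Y0` implies the ordering at the observed
    -- outcomes.
    have h := hq b a (S.Yobs a) (S.Y0 - S.Y1) (sub_nonneg.2 hnull)
    have e : S.Yobs a + indicators a * (S.Y0 - S.Y1) = S.Y0 := by
      rw [Study.Yobs]; ring
    rw [e] at h
    simp only at hab
    linarith

/-! ### The tail bound -/

section TailBound

variable {I : ℕ} (S : Study I) (w : UnitVec S.n)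

/-- The mean of the statistic with scores `w`. -/
def Study.totalMean : ℝ := ∑ i, mean (S.p i) (w i)

/-- The variance of the statistic with scores `w`. -/
def Study.totalVar : ℝ := ∑ i, var (S.p i) (w i)

variable {S w}

theorem Study.scale_le_totalVar : S.scale w ≤ S.totalVar w :=
  Finset.sum_le_sum fun i _ => scaledRange_le_var (S.two_le_n i) (S.p_mem i) (w i) le_rfl

theorem Study.scale_nonneg : 0 ≤ S.scale w :=
  Finset.sum_nonneg fun i _ =>
    scaledRange_nonneg _ (zero_le_one.trans (one_le_bias (S.p_mem i)))

theorem Study.scale_pos_of_rangeRatio_le {r : ℝ} (h : S.rangeRatio w ≤ (r : EReal)) :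
    0 < S.scale w := by
  refine lt_of_le_of_ne S.scale_nonneg fun h0 => ?_
  rw [Study.rangeRatio, if_pos h0.symm] at h
  exact absurd h (not_le.2 (EReal.coe_lt_top r))

theorem Study.sq_scoreRange_le {r : ℝ} (h : S.rangeRatio w ≤ (r : EReal)) (i : Fin I) :
    scoreRange (w i) ^ 2 ≤ r * S.scale w := by
  have h0 := S.scale_pos_of_rangeRatio_le h
  rw [Study.rangeRatio, if_neg h0.ne', EReal.coe_le_coe_iff, div_le_iff₀ h0] at h
  exact (le_ciSup (f := fun i => scoreRange (w i) ^ 2) (finite_range _).bddAbove i).trans h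

/-- After division by the standard deviation the terms are at most `δ`, because the squared ranges
are at most `δ ^ 2 * D` and `D` is at most the variance. That `r` is independent of `w` allows
scores chosen from the data. -/
theorem exists_tail_approximation {ε : ℝ} (hε : 0 < ε) : ∃ r : ℝ, 0 < r ∧
    ∀ {I : ℕ} {S : Study I} {w : UnitVec S.n}, S.rangeRatio w ≤ (r : EReal) → ∀ c : ℝ,
      S.prob {a | c ≤ ∑ i, w i (a i)} ≤
        gaussianTail ((c - S.totalMean w) / √(S.totalVar w)) + ε := by
  obtain ⟨δ, hδ, hclt⟩ := exists_normal_approximation hε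
  refine ⟨δ ^ 2, by positivity, fun {I S w} hr c => ?_⟩
  have hD := S.scale_pos_of_rangeRatio_le hr
  have hV : 0 < S.totalVar w := hD.trans_le S.scale_le_totalVar
  set s := √(S.totalVar w) with hs
  have hs0 : 0 < s := Real.sqrt_pos.2 hV
  have hss : s ^ 2 = S.totalVar w := Real.sq_sqrt hV.le
  have key := hclt (p := S.p) (x := fun i j => (w i j - mean (S.p i) (w i)) / s) S.p_mem ?_ ?_ ?_
    ((c - S.totalMean w) / s)
  · refine le_trans (le_of_eq ?_) key
    refine Finset.sum_congr rfl fun a _ => ?_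
    rw [indicator_apply]
    refine if_congr ?_ rfl rfl
    rw [mem_ofPred_eq, ← Finset.sum_div, Finset.sum_sub_distrib, div_le_div_iff_of_pos_right hs0,
      Study.totalMean, sub_le_sub_iff_right]
  · intro i
    have h : ∑ j, S.p i j * ((w i j - mean (S.p i) (w i)) / s) =
        (mean (S.p i) (w i) - (∑ j, S.p i j) * mean (S.p i) (w i)) / s := by
      rw [Finset.sum_mul]
      conv_rhs => lhs; lhs; rw [mean]
      rw [← Finset.sum_sub_distrib, Finset.sum_div]
      exact Finset.sum_congr rfl fun j _ => by ring
    rw [h, (S.p_mem i).2]; simp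
  · simp only [var_eq_sum_sq_div]
    rw [← Finset.sum_div, hss]
    exact div_self hV.ne'
  · intro i j
    rw [abs_div, abs_of_pos hs0, div_le_iff₀ hs0]
    refine (abs_sub_mean_le_scoreRange (S.p_mem i) (w i) j).trans ?_
    refine abs_le_of_sq_le_sq' ?_ (by positivity) |>.2
    calc _ ≤ δ ^ 2 * S.scale w := S.sq_scoreRange_le hr i
      _ ≤ δ ^ 2 * S.totalVar w := by gcongr; exact S.scale_le_totalVar
      _ = _ := by rw [mul_pow, hss]

/-- The analogue of `IsRankSet.mul_varOn_sub_le` for the passage from the true law to the extremal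
one, with sums over single sets in place of pairs. -/
theorem Study.mul_totalVar_sub_le {G : Fin I → EReal} (hG : ∀ i, S.Γ i ≤ G i) {C : ℝ}
    (hC : (C : EReal) ≤ S.meanVarRatio w G) (hC0 : 0 ≤ C) :
    C * (S.totalVar w - ∑ i, maxVar (w i) (G i)) ≤
      (∑ i, maxMean (w i) (G i) - S.totalMean w) * √(S.totalVar w) := by
  rw [Study.totalVar, Study.totalMean, ← Finset.sum_sub_distrib, ← Finset.sum_sub_distrib]
  have hgap : ∀ i, 0 ≤ maxMean (w i) (G i) - mean (S.p i) (w i) := fun i =>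
    sub_nonneg.2 (mean_le_maxMean (S.p_mem i) (w i) (hG i))
  have hV : ∑ i, (var (S.p i) (w i) - maxVar (w i) (G i)) ≤
      ∑ i ∈ S.excess w G, (var (S.p i) (w i) - maxVar (w i) (G i)) := by
    rw [Study.excess, Finset.sum_filter]
    refine Finset.sum_le_sum fun i _ => ?_
    split_ifs with hi <;> linarith
  have hM : ∑ i ∈ S.excess w G, (maxMean (w i) (G i) - mean (S.p i) (w i)) ≤
      ∑ i, (maxMean (w i) (G i) - mean (S.p i) (w i)) :=
    Finset.sum_le_sum_of_subset_of_nonneg (Finset.subset_univ _) fun i _ _ => hgap i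
  rcases Finset.eq_empty_or_nonempty (S.excess w G) with hs | hs
  · rw [hs, Finset.sum_empty] at hV
    exact (mul_nonpos_of_nonneg_of_nonpos hC0 hV).trans
      (mul_nonneg (Finset.sum_nonneg fun i _ => hgap i) (Real.sqrt_nonneg _))
  rw [Study.meanVarRatio, if_neg hs.ne_empty, EReal.coe_le_coe_iff, Study.deltaMean,
    Study.deltaVar] at hC
  have hN : (0 : ℝ) < (S.excess w G).card := by exact_mod_cast hs.card_pos
  have hD : 0 < ∑ i ∈ S.excess w G, (var (S.p i) (w i) - maxVar (w i) (G i)) :=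
    Finset.sum_pos (fun i hi => sub_pos.2 (Finset.mem_filter.1 hi).2) hs
  rw [mul_div_mul_left _ _ (inv_pos.2 hN).ne', div_mul_eq_mul_div, le_div_iff₀ hD] at hC
  calc _ ≤ C * ∑ i ∈ S.excess w G, (var (S.p i) (w i) - maxVar (w i) (G i)) :=
        mul_le_mul_of_nonneg_left hV hC0
    _ ≤ _ := hC
    _ ≤ _ := mul_le_mul hM (Real.sqrt_le_sqrt S.scale_le_totalVar) (Real.sqrt_nonneg _)
        (Finset.sum_nonneg fun i _ => hgap i)

/-- The p-values bound the tails of the statistic up to a uniform error. -/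
theorem exists_tail_le_pValue {ε : ℝ} (hε : 0 < ε) : ∃ r C : ℝ, 0 < r ∧
    ∀ {I : ℕ} {S : Study I} {w : UnitVec S.n} {G : EReal} {k : ℕ} {Jstar Jhat : Finset (Fin I)},
      S.rangeRatio w ≤ (r : EReal) → 1 ≤ G → 1 ≤ k → IsSmallestSet S.Γ k Jstar →
      orderStat S.Γ k ≤ G → IsRankSet w G k Jhat →
      (C : EReal) ≤ S.meanVarRatio w (partialBound Jstar G) →
      (C : EReal) ≤ swapRatio w G Jstar Jhat →
      ∀ T : ℝ, S.prob {a | T ≤ ∑ i, w i (a i)} ≤ pValue w T G k + ε := by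
  obtain ⟨r, hr, happ⟩ := exists_tail_approximation (half_pos hε)
  obtain ⟨C, hC0, hC⟩ : ∃ C : ℝ, 0 ≤ C ∧ gaussianTail (C / 2) ≤ ε / 2 := by
    have h1 : Tendsto (fun C : ℝ => gaussianTail (C / 2)) atTop (𝓝 0) :=
      tendsto_gaussianTail.comp (tendsto_id.atTop_div_const two_pos)
    obtain ⟨C, h2, h3⟩ := ((eventually_ge_atTop (0 : ℝ)).and
      (h1.eventually (eventually_le_nhds (half_pos hε)))).exists
    exact ⟨C, h2, h3⟩
  refine ⟨r, C, hr, ?_⟩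
  intro I S w G k Jstar Jhat hrange hG hk hJs hord hJh hA hB T
  by_cases hT : muRank w G k ≤ T
  swap
  · rw [pValue, if_neg fun h => hT h.2]
    linarith [S.prob_le_one {a | T ≤ ∑ i, w i (a i)}]
  rw [pValue, if_pos ⟨hk, hT⟩]
  have hbound : ∀ i, S.Γ i ≤ partialBound Jstar G i := by
    intro i
    unfold partialBound
    split_ifs with hi
    · exact hJs.le_of_orderStat_le hord hi
    · exact le_top
  have hV : 0 < S.totalVar w := (S.scale_pos_of_rangeRatio_le hrange).trans_le S.scale_le_totalVar
  -- The means increase along true law, `Jstar`, rank `k`, and the last stays at most `T`, so the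
  -- comparisons chain. The final variance step only enlarges the tail, and removing the truncation
  -- does so as well.
  have hmu1 : S.totalMean w ≤ muOn w G Jstar :=
    Finset.sum_le_sum fun i _ => mean_le_maxMean (S.p_mem i) (w i) (hbound i)
  have hmu2 : muOn w G Jstar ≤ muRank w G k := by
    rw [hJh.muRank_eq]; exact hJh.muOn_le hJs.1
  have h1 := truncTail_le_max hmu1 (hmu2.trans hT) hV.le (varOn_nonneg w G Jstar) hC0
    (S.mul_totalVar_sub_le hbound hA hC0)
  have hsw := hJh.mul_varOn_sub_le S.two_le_n hG hJs.1 hB hC0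
  rw [← hJh.muRank_eq] at hsw
  have h2 := truncTail_le_max hmu2 hT (varOn_nonneg w G Jstar) (varOn_nonneg w G Jhat) hC0 hsw
  have h3 := truncTail_mono hT (varOn_nonneg w G Jhat) hJh.varOn_le_varRank
  have h4 : truncTail (muRank w G k) (varRank w G k) T ≤ _ := min_le_right _ _
  have h5 := happ hrange T
  rw [← truncTail_of_pos hV (hmu1.trans (hmu2.trans hT))] at h5
  have h6 : truncTail (S.totalMean w) (S.totalVar w) T ≤
      (gaussianReal (muRank w G k) (varRank w G k).toNNReal).real (Ici T) + ε / 2 := by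
    have h7 : 0 ≤ (gaussianReal (muRank w G k) (varRank w G k).toNNReal).real (Ici T) :=
      MeasureTheory.measureReal_nonneg
    refine h1.trans (max_le (h2.trans (max_le ?_ ?_)) ?_) <;> linarith
  linarith

end TailBound

/-! ### Confidence sets from families of p-values -/

section Regions

variable {I : ℕ} {P : EReal → ℕ → ℝ} {α : ℝ} {v : Fin I → EReal}

theorem one_le_orderStat (hv : ∀ i, 1 ≤ v i) {k : ℕ} (hk : 1 ≤ k) : 1 ≤ orderStat v k := by
  refine le_sInf fun x hx => ?_
  obtain ⟨i, hi⟩ := Finset.card_pos.1 (lt_of_lt_of_le hk hx)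
  exact (hv i).trans (Finset.mem_filter.1 hi).2

theorem numExceeding_eq_sub (v : Fin I → EReal) (G : EReal) :
    numExceeding v G = I - (Finset.univ.filter fun i => v i ≤ G).card := by
  have h := Finset.card_filter_add_card_filter_not (s := Finset.univ) (fun i => v i ≤ G)
  simp only [not_le, Finset.card_univ, Fintype.card_fin] at h
  rw [numExceeding]
  omega

theorem mem_biasAlt_iff {G : EReal} {k : ℕ} :
    v ∈ biasAlt I G k ↔ (∀ i, 1 ≤ v i) ∧ G < orderStat v k :=
  ⟨fun h => ⟨h.1, not_le.1 fun h' => h.2 ⟨h.1, h'⟩⟩, fun h => ⟨h.1, fun h' => not_le.2 h.2 h'.2⟩⟩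

theorem quantileCI_subset_Icc (P : EReal → ℕ → ℝ) (α : ℝ) (k : ℕ) :
    quantileCI P α k ⊆ Icc (sInf (quantileCI P α k)) ⊤ :=
  fun _ h => ⟨sInf_le h, le_top⟩

theorem countCI_subset_Icc (I : ℕ) (P : EReal → ℕ → ℝ) (α : ℝ) (G : EReal) :
    countCI I P α G ⊆ Icc (countLower I P α G) I := by
  rintro _ ⟨k, hk, hP, rfl⟩
  have hb : BddAbove {k | k ≤ I ∧ α < P G k} := ⟨I, fun _ h => h.1⟩
  exact ⟨Nat.sub_le_sub_left (le_csSup hb ⟨hk, hP⟩) I, Nat.sub_le I k⟩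

theorem inter_quantileRegion_eq (I : ℕ) (P : EReal → ℕ → ℝ) (α : ℝ) :
    {v | ∀ i, 1 ≤ v i} ∩ ⋂ k ∈ Icc 1 I, quantileRegion I P α k = jointRegion I P α := by
  ext v
  simp only [mem_inter_iff, mem_ofPred_eq, mem_iInter, quantileRegion, jointRegion, mem_Icc]
  refine and_congr_right fun hv => ⟨fun h G k hG h1 hk hP => (h k ⟨h1, hk⟩).2 G hG hP,
    fun h k hk => ⟨hv, fun G hG hP => h G k hG hk.1 hk.2 hP⟩⟩

theorem inter_countRegion_eq (I : ℕ) (P : EReal → ℕ → ℝ) (α : ℝ) :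
    {v | ∀ i, 1 ≤ v i} ∩ ⋂ G ∈ Ici (1 : EReal), countRegion I P α G = jointRegion I P α := by
  ext v
  simp only [mem_inter_iff, mem_ofPred_eq, mem_iInter, countRegion, jointRegion, mem_Ici]
  exact and_congr_right fun hv => ⟨fun h G k hG h1 hk hP => (h G hG).2 k h1 hk hP,
    fun h G hG => ⟨hv, fun k h1 hk hP => h G k hG h1 hk hP⟩⟩

/-- The null at rank `k` whose threshold is `orderStat v k` itself contains `v`, so it cannot have
been rejected. -/
theorem orderStat_mem_quantileCI (h : v ∈ jointRegion I P α) {k : ℕ} (h1 : 1 ≤ k) (hk : k ≤ I) :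
    orderStat v k ∈ quantileCI P α k := by
  have h2 := one_le_orderStat h.1 h1
  refine ⟨h2, ?_⟩
  by_contra hP
  exact lt_irrefl _ (mem_biasAlt_iff.1 (h.2 _ k h2 h1 hk (not_lt.1 hP))).2

theorem jointRegion_subset_allQuantiles : jointRegion I P α ⊆ allQuantiles I P α :=
  fun _ h => ⟨h.1, fun _ h1 hk => orderStat_mem_quantileCI h h1 hk⟩

/-- With `k` the number of coordinates at most `G`, the null at `(G, k)` contains `v` and is not
rejected; for `k = 0` acceptance is the convention `h0`. -/
theorem numExceeding_mem_countCI (h0 : ∀ G, α < P G 0) (h : v ∈ jointRegion I P α) (G : EReal) :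
    numExceeding v G ∈ countCI I P α G := by
  rw [numExceeding_eq_sub]
  set k := (Finset.univ.filter fun i => v i ≤ G).card with hk
  have hkI : k ≤ I := by simpa using Finset.card_le_univ (Finset.univ.filter fun i => v i ≤ G)
  refine ⟨k, hkI, ?_, rfl⟩
  rcases Nat.eq_zero_or_pos k with hk0 | hk0
  · rw [hk0]; exact h0 G
  by_contra hP
  have hle : orderStat v k ≤ G := (orderStat_le_iff hkI).2 le_rfl
  have hG : 1 ≤ G := (one_le_orderStat h.1 hk0).trans hle
  exact absurd hle (not_le.2 (mem_biasAlt_iff.1 (h.2 G k hG hk0 hkI (not_lt.1 hP))).2)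

theorem jointRegion_subset_allCounts (h0 : ∀ G, α < P G 0) :
    jointRegion I P α ⊆ allCounts I P α :=
  fun _ h => ⟨h.1, fun G _ => numExceeding_mem_countCI h0 h G⟩

/-- If `orderStat v k ≤ G`, upward closure carries acceptance from `orderStat v k` to `G`, so no
rejected null contains `v`. -/
theorem allQuantiles_eq_jointRegion
    (h : ∀ k, 1 ≤ k → k ≤ I → IsUpperSet (quantileCI P α k)) :
    allQuantiles I P α = jointRegion I P α := by
  refine Subset.antisymm (fun v hv => ⟨hv.1, fun G k _ h1 hk hP => ?_⟩)
    jointRegion_subset_allQuantiles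
  refine mem_biasAlt_iff.2 ⟨hv.1, not_le.1 fun hle => ?_⟩
  exact absurd (h k h1 hk hle (hv.2 k h1 hk)).2 (not_lt.2 hP)

/-- If `orderStat v k ≤ G`, then `I - k` is at least the exceedance count of `v`, hence in the
interval, so `k` is accepted. -/
theorem allCounts_eq_jointRegion (h0 : ∀ G, α < P G 0)
    (h : ∀ G, 1 ≤ G → countCI I P α G = Icc (countLower I P α G) I) :
    allCounts I P α = jointRegion I P α := by
  refine Subset.antisymm (fun v hv => ⟨hv.1, fun G k hG _ hk hP => ?_⟩)
    (jointRegion_subset_allCounts h0)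
  refine mem_biasAlt_iff.2 ⟨hv.1, not_le.1 fun hle => ?_⟩
  have h2 := hv.2 G hG
  rw [h G hG, numExceeding_eq_sub] at h2
  have h3 := (orderStat_le_iff hk).1 hle
  have h4 : I - k ∈ countCI I P α G := by
    rw [h G hG]
    exact ⟨h2.1.trans (Nat.sub_le_sub_left h3 I), Nat.sub_le I k⟩
  obtain ⟨l, hl, hlP, hkl⟩ := h4
  have : k = l := by omega
  exact absurd hlP (not_lt.2 (this ▸ hP))

end Regions

/-! ### Coverage -/

theorem Study.modP_zero {I : ℕ} (S : Study I) (q : UnitVec S.n → UnitVec S.n) (kmin : ℕ)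
    (Gmax : EReal) (a : Assignment S.n) (G : EReal) : S.modP q kmin Gmax a G 0 = 1 := by
  simp [Study.modP, pValue]

theorem asympCovers_of_eventually {S : ∀ I, Study I} {α : ℝ} {E : ∀ I, Set (Assignment (S I).n)}
    (h : ∀ ε : ℝ, 0 < ε → ∀ᶠ I in atTop, 1 - α - ε ≤ (S I).prob (E I)) : AsympCovers S α E := by
  refine le_of_forall_sub_le fun ε hε => le_liminf_of_le ?_ (h ε hε)
  -- The real-valued `liminf` is meaningful only for bounded sequences; probabilities are at most
  -- `1`.
  exact (isBoundedUnder_of ⟨1, fun I => (S I).prob_le_one _⟩ :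
    IsBoundedUnder (· ≤ ·) atTop fun I => (S I).prob (E I)).isCoboundedUnder_ge

theorem lt_of_lt_uniformInf {I : ℕ} {S : Study I} {kmin k : ℕ} {Gmax G C : EReal}
    {f : ℕ → EReal → EReal} (h : C < S.uniformInf kmin Gmax f) (h1 : 1 ≤ k) (hmin : kmin ≤ k)
    (hk : k ≤ I) (hG : orderStat S.Γ k ≤ G) (hmax : G ≤ Gmax) : C < f k G :=
  h.trans_le (sInf_le ⟨k, G, h1, hmin, hk, hG, hmax, rfl⟩)

theorem eventually_le_prob_jointRegion {S : ∀ I, Study I}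
    {q : ∀ I, UnitVec (S I).n → UnitVec (S I).n}
    (hq : ∀ I, EffectIncreasing (stat (q I)) ∨ DifferentialIncreasing (stat (q I)))
    (hnull : ∀ I, (S I).BoundedNull) {kmin : ℕ → ℕ} {Gmax : ℕ → EReal}
    {Jstar : ∀ I, ℕ → Finset (Fin I)}
    (hJstar : ∀ I k, 1 ≤ k → k ≤ I → IsSmallestSet (S I).Γ k (Jstar I k))
    {Jhat : ∀ I, Assignment (S I).n → EReal → ℕ → Finset (Fin I)}
    (hJhat : ∀ I a G k, 1 ≤ G → 1 ≤ k → k ≤ I →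
      IsRankSet (q I ((S I).Yobs a)) G k (Jhat I a G k))
    (hcond : UniformConditions S q kmin Gmax Jstar Jhat) {α : ℝ} (hα : α ∈ Ioo (0 : ℝ) 1)
    {ε : ℝ} (hε : 0 < ε) :
    ∀ᶠ I in atTop, 1 - α - ε ≤
      (S I).prob {a | (S I).Γ ∈ jointRegion I ((S I).modP (q I) (kmin I) (Gmax I) a) α} := by
  have hε4 : 0 < ε / 4 := by positivity
  obtain ⟨r, C, hr, htail⟩ := exists_tail_le_pValue hε4
  filter_upwards [(hcond.range_ratio r hr).eventually (eventually_le_nhds hε4),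
    (hcond.mean_var_ratio C).eventually (eventually_le_nhds hε4),
    (hcond.swap_ratio C).eventually (eventually_le_nhds hε4)] with I b1 b2 b3
  set E := {a | (S I).Γ ∈ jointRegion I ((S I).modP (q I) (kmin I) (Gmax I) a) α} with hE
  obtain ⟨h, hh⟩ := (S I).exists_score_of_boundedNull (hnull I) (hq I)
  set B1 := {a | (r : EReal) < (S I).rangeRatio (q I ((S I).Yobs a))}
  set B2 := {a | (S I).uniformInf (kmin I) (Gmax I) (fun k G =>
    (S I).meanVarRatio (q I ((S I).Yobs a)) (partialBound (Jstar I k) G)) ≤ (C : EReal)}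
  set B3 := {a | (S I).uniformInf (kmin I) (Gmax I) (fun k G =>
    swapRatio (q I ((S I).Yobs a)) G (Jstar I k) (Jhat I a G k)) ≤ (C : EReal)}
  -- Each of the three bad events costs `ε / 4`, and the last quarter is the tail approximation
  -- error. The fourth event is the same for every rejected `(G, k)`.
  have hsub : Eᶜ ⊆ B1 ∪ (B2 ∪ (B3 ∪ {a | (S I).prob {b | h a ≤ h b} ≤ α + ε / 4})) := by
    intro a ha
    by_contra hcon
    simp only [mem_union, not_or] at hcon
    obtain ⟨g1, g2, g3, g4⟩ := hcon
    refine ha ⟨fun i => one_le_bias ((S I).p_mem i), fun G k hG h1 hk hP =>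
      mem_biasAlt_iff.2 ⟨fun i => one_le_bias ((S I).p_mem i), not_le.1 fun hle => g4 ?_⟩⟩
    -- A modified p-value of `1` never rejects, so a rejection happens only in the range covered by
    -- the uniform conditions.
    have hGk : G ≤ Gmax I ∧ kmin I ≤ k := by
      by_contra hn
      rw [Study.modP, if_neg hn] at hP
      exact absurd hP (not_le.2 hα.2)
    rw [Study.modP, if_pos hGk] at hP
    have key := htail (not_lt.1 g1) hG h1 (hJstar I k h1 hk) hle (hJhat I a G k hG h1 hk)
      (lt_of_lt_uniformInf (not_le.1 g2) h1 hGk.2 hk hle hGk.1).le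
      (lt_of_lt_uniformInf (not_le.1 g3) h1 hGk.2 hk hle hGk.1).le
      (stat (q I) a ((S I).Yobs a))
    simp only [← stat_eq] at key
    exact ((S I).prob_mono fun b hb => hh a b hb).trans (key.trans (by linarith))
  have h1 := (S I).prob_mono hsub
  have h2 := (S I).prob_union_le B1 (B2 ∪ (B3 ∪ {a | (S I).prob {b | h a ≤ h b} ≤ α + ε / 4}))
  have h3 := (S I).prob_union_le B2 (B3 ∪ {a | (S I).prob {b | h a ≤ h b} ≤ α + ε / 4})
  have h4 := (S I).prob_union_le B3 {a | (S I).prob {b | h a ≤ h b} ≤ α + ε / 4}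
  have h5 := (S I).prob_tail_le h (β := α + ε / 4) (by linarith [hα.1])
  have h6 := (S I).prob_add_prob_compl E
  linarith

end MatchedSets

end

theorem theoremA5
    (S : ∀ I : ℕ, MatchedSets.Study I)
    (q : ∀ I : ℕ, MatchedSets.UnitVec (S I).n → MatchedSets.UnitVec (S I).n)
    (hq : ∀ I, MatchedSets.EffectIncreasing (MatchedSets.stat (q I)) ∨
      MatchedSets.DifferentialIncreasing (MatchedSets.stat (q I)))
    (hnull : ∀ I, (S I).BoundedNull)
    (kmin : ℕ → ℕ) (Gmax : ℕ → EReal)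
    (Jstar : ∀ I : ℕ, ℕ → Finset (Fin I))
    (hJstar : ∀ I k, 1 ≤ k → k ≤ I → MatchedSets.IsSmallestSet (S I).Γ k (Jstar I k))
    (Jhat : ∀ I : ℕ, MatchedSets.Assignment (S I).n → EReal → ℕ → Finset (Fin I))
    (hJhat : ∀ I a G k, 1 ≤ G → 1 ≤ k → k ≤ I →
      MatchedSets.IsRankSet (q I ((S I).Yobs a)) G k (Jhat I a G k))
    (hcond : MatchedSets.UniformConditions S q kmin Gmax Jstar Jhat)
    (P : ∀ I : ℕ, MatchedSets.Assignment (S I).n → EReal → ℕ → ℝ)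
    (hP : P = fun I a G k => (S I).modP (q I) (kmin I) (Gmax I) a G k)
    (α : ℝ) (hα : α ∈ Set.Ioo (0 : ℝ) 1) :
    -- confidence sets for the hidden bias at each rank
    (∀ k : ℕ → ℕ, (∀ᶠ I in Filter.atTop, 1 ≤ k I ∧ k I ≤ I) →
      MatchedSets.AsympCovers S α fun I =>
        {a | MatchedSets.orderStat (S I).Γ (k I) ∈ MatchedSets.quantileCI (P I a) α (k I)}) ∧
    (∀ I a k, 1 ≤ k → k ≤ I → MatchedSets.quantileCI (P I a) α k ⊆
      Set.Icc (sInf (MatchedSets.quantileCI (P I a) α k)) ⊤) ∧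
    -- confidence sets for the number of hidden biases exceeding each threshold
    (∀ G : ℕ → EReal,
      MatchedSets.AsympCovers S α fun I =>
        {a | MatchedSets.numExceeding (S I).Γ (G I) ∈ MatchedSets.countCI I (P I a) α (G I)}) ∧
    (∀ I a G, MatchedSets.countCI I (P I a) α G ⊆
      Set.Icc (MatchedSets.countLower I (P I a) α G) I) ∧
    -- the equivalent forms of the joint confidence set for the vector of hidden biases
    (∀ I a,
      (({v | ∀ i, 1 ≤ v i} ∩ ⋂ k ∈ Set.Icc 1 I, MatchedSets.quantileRegion I (P I a) α k) =
        MatchedSets.jointRegion I (P I a) α) ∧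
      (({v | ∀ i, 1 ≤ v i} ∩ ⋂ G ∈ Set.Ici (1 : EReal),
        MatchedSets.countRegion I (P I a) α G) = MatchedSets.jointRegion I (P I a) α) ∧
      MatchedSets.jointRegion I (P I a) α ⊆ MatchedSets.allQuantiles I (P I a) α ∧
      MatchedSets.jointRegion I (P I a) α ⊆ MatchedSets.allCounts I (P I a) α ∧
      ((∀ k, 1 ≤ k → k ≤ I → IsUpperSet (MatchedSets.quantileCI (P I a) α k)) →
        MatchedSets.allQuantiles I (P I a) α = MatchedSets.jointRegion I (P I a) α) ∧
      ((∀ G, 1 ≤ G → MatchedSets.countCI I (P I a) α G =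
          Set.Icc (MatchedSets.countLower I (P I a) α G) I) →
        MatchedSets.allCounts I (P I a) α = MatchedSets.jointRegion I (P I a) α)) ∧
    -- simultaneous coverage of the vector of hidden biases
    (MatchedSets.AsympCovers S α fun I => {a | (S I).Γ ∈ MatchedSets.jointRegion I (P I a) α}) ∧
    (MatchedSets.AsympCovers S α fun I => {a | (S I).Γ ∈ MatchedSets.allQuantiles I (P I a) α}) ∧
    (MatchedSets.AsympCovers S α fun I =>
      {a | (S I).Γ ∈ MatchedSets.allCounts I (P I a) α}) := by
  -- Every other coverage event contains the joint one, so its probability inherits the lower bound.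
  subst hP
  have hcov := fun ε hε => MatchedSets.eventually_le_prob_jointRegion (ε := ε)
    hq hnull hJstar hJhat hcond hα hε
  have hzero : ∀ I a G, α < (S I).modP (q I) (kmin I) (Gmax I) a G 0 := fun I a G => by
    rw [MatchedSets.Study.modP_zero]; exact hα.2
  refine ⟨fun k hk => MatchedSets.asympCovers_of_eventually fun ε hε => ?_,
    fun I a k _ _ => MatchedSets.quantileCI_subset_Icc _ _ _,
    fun G => MatchedSets.asympCovers_of_eventually fun ε hε => ?_,
    fun I a G => MatchedSets.countCI_subset_Icc _ _ _ _,
    fun I a => ⟨MatchedSets.inter_quantileRegion_eq _ _ _, MatchedSets.inter_countRegion_eq _ _ _,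
      MatchedSets.jointRegion_subset_allQuantiles,
      MatchedSets.jointRegion_subset_allCounts (hzero I a),
      MatchedSets.allQuantiles_eq_jointRegion,
      MatchedSets.allCounts_eq_jointRegion (hzero I a)⟩,
    MatchedSets.asympCovers_of_eventually fun ε hε => hcov ε hε,
    MatchedSets.asympCovers_of_eventually fun ε hε => ?_,
    MatchedSets.asympCovers_of_eventually fun ε hε => ?_⟩
  · filter_upwards [hcov ε hε, hk] with I hI hkI
    exact hI.trans ((S I).prob_mono fun a ha =>
      MatchedSets.orderStat_mem_quantileCI ha hkI.1 hkI.2)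
  · filter_upwards [hcov ε hε] with I hI
    exact hI.trans ((S I).prob_mono fun a ha =>
      MatchedSets.numExceeding_mem_countCI (hzero I a) ha (G I))
  · filter_upwards [hcov ε hε] with I hI
    exact hI.trans ((S I).prob_mono fun a ha => MatchedSets.jointRegion_subset_allQuantiles ha)
  · filter_upwards [hcov ε hε] with I hI
    exact hI.trans ((S I).prob_mono fun a ha =>
      MatchedSets.jointRegion_subset_allCounts (hzero I a) ha)
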